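/- Let $\mathcal{L}_A=\{+,\cdot,\mathrm{S},<,0\}$ be the language of arithmetic. A $\Delta_0$-formula is an $\mathcal{L}_A$-formula all of whose quantifiers are of the form $\exists x<t$ or $\forall x<t$, with $t$ a term not containing $x$; a $\Sigma_1$-formula is a $\Delta_0$-formula preceded by a finite (possibly empty) block of existential quantifiers. $\mathrm{I}\Delta_0$ is $\mathrm{PA}^-$ (the theory of non-negative parts of discretely ordered rings) together with induction for $\Delta_0$-formulae with parameters, and $\mathrm{B}\Sigma_1$ consists of the universal closures of $$[\forall x<v\,\exists y\,\varphi(x,y)]\rightarrow\exists z\,[\forall x<v\,\exists y<z\,\varphi(x,y)],$$ where $\varphi$ is $\Sigma_1$ and may contain parameters. Call a $\Delta_0$-formula $\mathrm{Exp}(x,y)$ an exponentiation formula if $\mathrm{I}\Delta_0$ proves $\mathrm{Exp}(0,1)$ and the three statements $\forall x\,\exists^{\leq 1}y\,\mathrm{Exp}(x,y)$; $\forall x\,(\exists y\,\mathrm{Exp}(x,y)\rightarrow\forall z<x\,\exists y\,\mathrm{Exp}(z,y))$; $\forall x\,\forall y\,(\mathrm{Exp}(x,y)\rightarrow\mathrm{Exp}(x+1,2y))$.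 (It then defines the graph of the possibly partial function $x\mapsto 2^x$ in every model of $\mathrm{I}\Delta_0$.) Given such a formula, $\mathrm{Exp}$ also denotes the axiom $\forall x\,\exists y\,\mathrm{Exp}(x,y)$. **Theorem 3.2.** Let $\mathcal{M}\models\mathrm{I}\Delta_0$ have universe $M$, and let $j$ be a self-embedding of $\mathcal{M}$ (an isomorphism of $\mathcal{M}$ onto a submodel $j(\mathcal{M})$ of $\mathcal{M}$) that is nontrivial, i.e. not the identity map, and such that $j(\mathcal{M})\preceq_{\Delta_0}\mathcal{M}$, i.e. $\Delta_0$-formulae with parameters in $j(\mathcal{M})$ are absolute between $j(\mathcal{M})$ and $\mathcal{M}$. Put $$\mathrm{I}_{\mathrm{fix}}(j)=\{m\in M:\ j(x)=x\text{ for all }x\leq m\}.$$ Then an exponentiation formula exists, and for every exponentiation formula $\mathrm{Exp}(x,y)$ the set $\mathrm{I}_{\mathrm{fix}}(j)$ is the universe of a submodel of $\mathcal{M}$ that satisfies $\mathrm{I}\Delta_0+\mathrm{B}\Sigma_1+\mathrm{Exp}$. In particular, $\mathrm{I}_{\mathrm{fix}}(j)$ is closed under exponentiation: for every $a\in\mathrm{I}_{\mathrm{fix}}(j)$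 there is $b\in\mathrm{I}_{\mathrm{fix}}(j)$ with $\mathcal{M}\models\mathrm{Exp}(a,b)$. -/

import Mathlib

universe u

open FirstOrder

namespace Arith

/-! ### The language of arithmetic -/

/-- Function symbols of the language of arithmetic: `0`, `S`, `+`, `·`. -/
inductive Func : ℕ → Type
  | zero : Func 0
  | succ : Func 1
  | add : Func 2
  | mul : Func 2

/-- Relation symbols of the language of arithmetic: `<`. -/
inductive Rel : ℕ → Type
  | lt : Rel 2

end Arith

/-- The language `{+, ·, S, <, 0}` of first-order arithmetic. -/
def LA : Language := ⟨Arith.Func, Arith.Rel⟩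

namespace Arith

open FirstOrder.Language

section Terms

variable {β : Type u}

instance : Zero (LA.Term β) := ⟨Constants.term (L := LA) Func.zero⟩

instance : Add (LA.Term β) := ⟨Functions.apply₂ (L := LA) Func.add⟩

instance : Mul (LA.Term β) := ⟨Functions.apply₂ (L := LA) Func.mul⟩

/-- The term `S t`. -/
def S (t : LA.Term β) : LA.Term β := Functions.apply₁ (L := LA) Func.succ t

/-- The numeral `1`, that is, `S 0`. -/
instance : One (LA.Term β) := ⟨S 0⟩

/-- The atomic formula `t < s`. -/
def lt {n : ℕ} (t s : LA.Term (β ⊕ Fin n)) : LA.BoundedFormula β n :=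
  Relations.boundedFormula₂ (L := LA) Rel.lt t s

/-- Regard a term in which `n` quantifiable variables may occur as a term in which one further
variable `&n` may occur (but does not). -/
def wk {n : ℕ} (t : LA.Term (β ⊕ Fin n)) : LA.Term (β ⊕ Fin (n + 1)) :=
  t.relabel (Sum.map id Fin.castSucc)

/-- The bounded quantifier `∀ x < t, φ`, where the new variable `x = &n` does not occur in `t`. -/
def ballLT {n : ℕ} (t : LA.Term (β ⊕ Fin n)) (φ : LA.BoundedFormula β (n + 1)) :
    LA.BoundedFormula β n :=
  ∀' (lt (&(Fin.last n)) (wk t) ⟹ φ)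

/-- The bounded quantifier `∃ x < t, φ`, where the new variable `x = &n` does not occur in `t`. -/
def bexLT {n : ℕ} (t : LA.Term (β ⊕ Fin n)) (φ : LA.BoundedFormula β (n + 1)) :
    LA.BoundedFormula β n :=
  ∃' (lt (&(Fin.last n)) (wk t) ⊓ φ)

/-- `Δ₀`-formulae: all quantifiers are of the form `∀ x < t` or `∃ x < t`. -/
inductive IsDelta0 : ∀ {n : ℕ}, LA.BoundedFormula β n → Prop
  | falsum {n : ℕ} : IsDelta0 (⊥ : LA.BoundedFormula β n)
  | equal {n : ℕ} (t s : LA.Term (β ⊕ Fin n)) : IsDelta0 (t.bdEqual s)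
  | rel {n l : ℕ} (R : LA.Relations l) (ts : Fin l → LA.Term (β ⊕ Fin n)) :
      IsDelta0 (BoundedFormula.rel R ts)
  | imp {n : ℕ} {φ ψ : LA.BoundedFormula β n} :
      IsDelta0 φ → IsDelta0 ψ → IsDelta0 (φ ⟹ ψ)
  | ball {n : ℕ} (t : LA.Term (β ⊕ Fin n)) {φ : LA.BoundedFormula β (n + 1)} :
      IsDelta0 φ → IsDelta0 (ballLT t φ)
  | bex {n : ℕ} (t : LA.Term (β ⊕ Fin n)) {φ : LA.BoundedFormula β (n + 1)} :
      IsDelta0 φ → IsDelta0 (bexLT t φ)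

/-- `Σ₁`-formulae: a finite (possibly empty) block of existential quantifiers followed by a
`Δ₀`-formula. -/
inductive IsSigma1 : ∀ {n : ℕ}, LA.BoundedFormula β n → Prop
  | delta0 {n : ℕ} {φ : LA.BoundedFormula β n} : IsDelta0 φ → IsSigma1 φ
  | ex {n : ℕ} {φ : LA.BoundedFormula β (n + 1)} : IsSigma1 φ → IsSigma1 (∃' φ)

end Terms

/-! ### Theories -/

/-- `PA⁻`: the theory of non-negative parts of discretely ordered rings, with `S x = x + 1`. -/
inductive PAMinus : LA.Theory
  | add_assoc : PAMinus (∀' ∀' ∀' (((&0 + &1) + &2) =' (&0 + (&1 + &2))))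
  | add_comm : PAMinus (∀' ∀' ((&0 + &1) =' (&1 + &0)))
  | mul_assoc : PAMinus (∀' ∀' ∀' (((&0 * &1) * &2) =' (&0 * (&1 * &2))))
  | mul_comm : PAMinus (∀' ∀' ((&0 * &1) =' (&1 * &0)))
  | mul_add : PAMinus (∀' ∀' ∀' ((&0 * (&1 + &2)) =' (&0 * &1 + &0 * &2)))
  | add_zero : PAMinus (∀' ((&0 + 0) =' &0))
  | mul_zero : PAMinus (∀' ((&0 * 0) =' 0))
  | mul_one : PAMinus (∀' ((&0 * 1) =' &0))
  | succ_eq : PAMinus (∀' (S &0 =' (&0 + 1)))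
  | lt_trans : PAMinus (∀' ∀' ∀' (lt &0 &1 ⊓ lt &1 &2 ⟹ lt &0 &2))
  | lt_irrefl : PAMinus (∀' ∼(lt &0 &0))
  | lt_total : PAMinus (∀' ∀' (lt &0 &1 ⊔ ((&0 =' &1) ⊔ lt &1 &0)))
  | add_lt_add : PAMinus (∀' ∀' ∀' (lt &0 &1 ⟹ lt (&0 + &2) (&1 + &2)))
  | mul_lt_mul : PAMinus (∀' ∀' ∀' (lt 0 &2 ⊓ lt &0 &1 ⟹ lt (&0 * &2) (&1 * &2)))
  | exists_add : PAMinus (∀' ∀' (lt &0 &1 ⟹ ∃' ((&0 + &2) =' &1)))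
  | zero_lt_one : PAMinus (lt 0 1)
  | discrete : PAMinus (∀' (lt 0 &0 ⟹ (lt 1 &0 ⊔ (1 =' &0))))
  | nonneg : PAMinus (∀' (lt 0 &0 ⊔ (0 =' &0)))

/-- The formula `φ` with its free variables renamed along `g`, where a value `Sum.inr i` stands for
the quantifiable variable `&i`. -/
def ren {α β : Type} {n : ℕ} (g : α → β ⊕ Fin n) (φ : LA.Formula α) : LA.BoundedFormula β n :=
  BoundedFormula.relabel (k := 0) g φ

/-- The universal closure of a formula with `k` free variables. -/
def close {k : ℕ} (φ : LA.Formula (Fin k)) : LA.Sentence :=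
  (ren (Sum.inr : Fin k → Empty ⊕ Fin k) φ).alls

/-- The induction axiom for `φ(p, x)`, where `p` is a `k`-tuple of parameters: the universal
closure of `φ(p, 0) ∧ ∀ x (φ(p, x) → φ(p, S x)) → ∀ x φ(p, x)`. -/
def inductionAxiom {k : ℕ} (φ : LA.Formula (Fin k ⊕ Fin 1)) : LA.Sentence :=
  close <|
    (φ.subst (Sum.elim Term.var fun _ => 0) ⊓
      ∀' (ren id φ ⟹
        ren id (φ.subst
          (Sum.elim (fun i => Term.var (Sum.inl i)) fun i => S (Term.var (Sum.inr i)))))) ⟹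
      ∀' (ren id φ)

/-- The collection axiom for `φ(p, x, y)`, where `p` is a `k`-tuple of parameters: the universal
closure of `(∀ x < v, ∃ y, φ(p, x, y)) → ∃ z, ∀ x < v, ∃ y < z, φ(p, x, y)`.
In the antecedent the variables `v, x, y` are `&0, &1, &2`; in the consequent the variables
`v, z, x, y` are `&0, &1, &2, &3`. -/
def collectionAxiom {k : ℕ} (φ : LA.Formula (Fin k ⊕ Fin 2)) : LA.Sentence :=
  close <|
    ∀' (ballLT &0 (∃' (ren (n := 3) (Sum.map id ![1, 2]) φ)) ⟹
      ∃' (ballLT &0 (bexLT &1 (ren (n := 4) (Sum.map id ![2, 3]) φ))))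

/-- `IΔ₀`: `PA⁻` together with induction for `Δ₀`-formulae (with parameters). -/
def IDelta0 : LA.Theory :=
  PAMinus ∪ {σ | ∃ (k : ℕ) (φ : LA.Formula (Fin k ⊕ Fin 1)), IsDelta0 φ ∧ σ = inductionAxiom φ}

/-- `BΣ₁`: the collection scheme for `Σ₁`-formulae (with parameters). -/
def BSigma1 : LA.Theory :=
  {σ | ∃ (k : ℕ) (φ : LA.Formula (Fin k ⊕ Fin 2)), IsSigma1 φ ∧ σ = collectionAxiom φ}

/-! ### The graph of exponentiation -/

/-- `E(t, s)`, for a formula `E` in two free variables and terms `t`, `s`. -/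
def app {n : ℕ} (E : LA.Formula (Fin 2)) (t s : LA.Term (Empty ⊕ Fin n)) :
    LA.BoundedFormula Empty n :=
  ren id (E.subst ![t, s])

/-- `E(x, y)` is a `Δ₀`-formula which `IΔ₀` proves to be the graph of `x ↦ 2 ^ x`, a possibly
partial function whose domain is an initial segment. Any two such formulae are `IΔ₀`-provably
equivalent. -/
structure IsExpGraph (E : LA.Formula (Fin 2)) : Prop where
  delta0 : IsDelta0 E
  /-- `E(0, 1)`. -/
  zero : IDelta0 ⊨ᵇ (app E 0 1 : LA.Sentence)
  /-- For every `x` there is at most one `y` with `E(x, y)`. -/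
  unique : IDelta0 ⊨ᵇ (∀' ∀' ∀' (app E &0 &1 ⊓ app E &0 &2 ⟹ (&1 =' &2)) : LA.Sentence)
  /-- If `E(x, y)` for some `y` and `z < x`, then `E(z, y)` for some `y`. -/
  initial : IDelta0 ⊨ᵇ
    (∀' ((∃' app E &0 &1) ⟹ ballLT &0 (∃' app E &1 &2)) : LA.Sentence)
  /-- `E(x, y)` implies `E(x + 1, 2 * y)`. -/
  succ : IDelta0 ⊨ᵇ
    (∀' ∀' (app E &0 &1 ⟹ app E (&0 + 1) ((1 + 1) * &1)) : LA.Sentence)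

/-- The axiom `∀ x ∃ y E(x, y)`. -/
def totality (E : LA.Formula (Fin 2)) : LA.Sentence := ∀' ∃' app E &0 &1

/-! ### Self-embeddings -/

section Models

variable {M : Type u} [LA.Structure M]

/-- The order of an `LA`-structure. -/
def Lt (a b : M) : Prop := Structure.RelMap (L := LA) Rel.lt ![a, b]

/-- `N ≼_{Δ₀} M`: `Δ₀`-formulae with parameters in `N` are absolute between `N` and `M`. -/
def IsDelta0Elementary (N : LA.Substructure M) : Prop :=
  ∀ (k : ℕ) (φ : LA.Formula (Fin k)), IsDelta0 φ →
    ∀ a : Fin k → N, φ.Realize a ↔ φ.Realize (fun i => (a i : M))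

/-- `I_fix(j)`, the longest initial segment of fixed points of `j`: the set of all `m` such that
`j x = x` for every `x ≤ m`. -/
def Ifix (j : M ↪[LA] M) : Set M := {m | ∀ x : M, Lt x m ∨ x = m → j x = x}

end Models

end Arith

/-! Closure under exponentiation rests on binary digits. Let `j` fix every `i ≤ a`, and let `x < 2 ^
a`. Since the graph of exponentiation is `Δ₀`, `j` respects it, and as it is functional, `j` fixes
each existing `2 ^ i` with `i ≤ a`. So `j` maps the quotient of `x` by `2 ^ i` to that of `j x`.
Passing to `2 ^ (i + 1)` drops a digit `0` or `1`, which `j` fixes; hence if the two quotients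
differ at `i`, they differ at `i + 1`. Were `j x ≠ x`, they would differ from `i = 0` up to `i = a`,
where both vanish. This is `map_eq_of_lt_exp`. The induction is `Δ₀` although `j` is not definable:
only `x` and `j x` occur as parameters, and two distinct quotients force `2 ^ i ≤ x + j x`. If `2 ^
a` did not exist, the argument would apply to every `x`, making `j` the identity.

`Ifix j` is an initial segment closed under the operations, so `Δ₀`-formulae are absolute for it and
`IΔ₀` is inherited (`IsInitial.models_IDelta0`). It is proper because `j` moves something, and
collection holds in proper initial segments by underspill (`IsInitial.models_BSigma1`).

An exponentiation formula is built from the congruence `(m + 1) ^ n ≡ 1 + n * m` modulo `m ^ 2`, by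
which a power of `m + 1` reveals its exponent modulo `m`. For `m + 1 = 2 ^ d`, a power of two is `(m
+ 1) ^ n * 2 ^ r` with `r < d`. The base must be large enough that `n` does not reach `m`, yet small
enough that the witnesses for `r` stay below a fixed multiple of `y`; the least admissible base
achieves both (`exists_suitable`, `Suitable.exists_smallExp`). `BaseExp.unique` makes the exponent
independent of the base, whence the recursion equations. -/

namespace Arith

open FirstOrder.Language

/-! ### The ordered ring of differences, where inequalities of the semiring can be rearranged by
subtraction. -/

section DiffRing

variable {M : Type u} [CommSemiring M] [LinearOrder M] [IsStrictOrderedRing M]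

/-- Two formal differences are equivalent if they have the same value. -/
def diffSetoid (M : Type u) [CommSemiring M] [LinearOrder M] [IsStrictOrderedRing M] :
    Setoid (M × M) where
  r p q := p.1 + q.2 = q.1 + p.2
  iseqv := ⟨fun _ => rfl, fun h => h.symm, fun {a b c} h₁ h₂ => by grind⟩

/-- The ordered ring of formal differences of elements of an ordered semiring. -/
def DiffRing (M : Type u) [CommSemiring M] [LinearOrder M] [IsStrictOrderedRing M] : Type u :=
  Quotient (diffSetoid M)

namespace DiffRing

/-- The formal difference `a - b`. -/
def mk (a b : M) : DiffRing M := Quotient.mk (diffSetoid M) (a, b)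

lemma mk_eq {a b c d : M} : mk a b = mk c d ↔ a + d = c + b :=
  ⟨fun h => Quotient.exact h, fun h => Quotient.sound h⟩

lemma ind {p : DiffRing M → Prop} (h : ∀ a b, p (mk a b)) (x) : p x :=
  Quotient.ind (fun y => h y.1 y.2) x

instance : Zero (DiffRing M) := ⟨mk 0 0⟩
instance : One (DiffRing M) := ⟨mk 1 0⟩
instance : Add (DiffRing M) := ⟨Quotient.lift₂ (fun p q => mk (p.1 + q.1) (p.2 + q.2))
  fun p q p' q' (h : _ = _) (h' : _ = _) => mk_eq.2 (by grind)⟩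
instance : Neg (DiffRing M) := ⟨Quotient.lift (fun p => mk p.2 p.1)
  fun p q (h : _ = _) => mk_eq.2 (by grind)⟩
instance : Mul (DiffRing M) :=
  ⟨Quotient.lift₂ (fun p q => mk (p.1 * q.1 + p.2 * q.2) (p.1 * q.2 + p.2 * q.1))
  fun p q p' q' (h : _ = _) (h' : _ = _) => mk_eq.2 (by
    obtain ⟨a, b⟩ := p
    obtain ⟨a', b'⟩ := p'
    obtain ⟨c, d⟩ := q
    obtain ⟨c', d'⟩ := q'
    simp only at h h' ⊢
    -- The factors are replaced one at a time, passing through mixed products that cancel at the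
    -- end.
    have e₁ : a * c + b' * c = a' * c + b * c := by rw [← add_mul, h, add_mul]
    have e₂ : a * d + b' * d = a' * d + b * d := by rw [← add_mul, h, add_mul]
    have e₃ : a' * c + a' * d' = a' * c' + a' * d := by rw [← mul_add, h', mul_add]
    have e₄ : b' * c + b' * d' = b' * c' + b' * d := by rw [← mul_add, h', mul_add]
    apply add_right_cancel (b := b' * c + a' * d)
    calc _ = (a * c + b' * c) + b * d + (a' * d) + a' * d' + b' * c' := by ring
      _ = (a * d + b' * d) + b * c + (a' * c + a' * d') + b' * c' := by
          rw [e₁, e₂]; ring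
      _ = _ := by rw [e₃]; ring_nf; grind)⟩

lemma add_mk (a b c d : M) : mk a b + mk c d = mk (a + c) (b + d) := rfl
lemma mul_mk (a b c d : M) : mk a b * mk c d = mk (a * c + b * d) (a * d + b * c) := rfl
lemma neg_mk (a b : M) : -mk a b = mk b a := rfl
lemma zero_def : (0 : DiffRing M) = mk 0 0 := rfl
lemma one_def : (1 : DiffRing M) = mk 1 0 := rfl

instance : CommRing (DiffRing M) where
  add_assoc x y z := by
    induction x using ind; induction y using ind; induction z using ind
    simp only [add_mk, mk_eq]; ring
  zero_add x := by induction x using ind; simp only [zero_def, add_mk, mk_eq]; ring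
  add_zero x := by induction x using ind; simp only [zero_def, add_mk, mk_eq]; ring
  add_comm x y := by
    induction x using ind; induction y using ind
    simp only [add_mk, mk_eq]; ring
  mul_assoc x y z := by
    induction x using ind; induction y using ind; induction z using ind
    simp only [mul_mk, mk_eq]; ring
  mul_comm x y := by
    induction x using ind; induction y using ind
    simp only [mul_mk, mk_eq]; ring
  left_distrib x y z := by
    induction x using ind; induction y using ind; induction z using ind
    simp only [add_mk, mul_mk, mk_eq]; ring
  right_distrib x y z := by
    induction x using ind; induction y using ind; induction z using ind
    simp only [add_mk, mul_mk, mk_eq]; ring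
  zero_mul x := by induction x using ind; simp only [zero_def, mul_mk, mk_eq]; ring
  mul_zero x := by induction x using ind; simp only [zero_def, mul_mk, mk_eq]; ring
  one_mul x := by induction x using ind; simp only [one_def, mul_mk, mk_eq]; ring
  mul_one x := by induction x using ind; simp only [one_def, mul_mk, mk_eq]; ring
  neg_add_cancel x := by
    induction x using ind; simp only [zero_def, neg_mk, add_mk, mk_eq]; ring
  nsmul := nsmulRec
  zsmul := zsmulRec

instance : LE (DiffRing M) := ⟨Quotient.lift₂ (fun p q => p.1 + q.2 ≤ q.1 + p.2)
  fun p q p' q' (h : _ = _) (h' : _ = _) =>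
    propext ⟨fun H => by grind, fun H => by grind⟩⟩

lemma mk_le {a b c d : M} : mk a b ≤ mk c d ↔ a + d ≤ c + b := Iff.rfl

noncomputable instance : LinearOrder (DiffRing M) where
  le_refl x := by induction x using ind; exact le_rfl
  le_trans x y z h h' := by
    induction x using ind; induction y using ind; induction z using ind
    simp only [mk_le] at *; grind
  le_antisymm x y h h' := by
    induction x using ind; induction y using ind
    simp only [mk_le, mk_eq] at *; grind
  le_total x y := by
    induction x using ind; induction y using ind
    exact le_total _ _
  toDecidableLE := Classical.decRel _

instance [ExistsAddOfLE M] : IsStrictOrderedRing (DiffRing M) :=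
  have : IsOrderedAddMonoid (DiffRing M) :=
    { add_le_add_left := fun x y h z => by
        induction x using ind; induction y using ind; induction z using ind
        simp only [mk_le, add_mk] at *; grind }
  have : Nontrivial (DiffRing M) := ⟨0, 1, fun h => by
    rw [zero_def, one_def, mk_eq] at h; simp at h⟩
  have : ZeroLEOneClass (DiffRing M) := ⟨by rw [zero_def, one_def, mk_le]; simp⟩
  IsStrictOrderedRing.of_mul_pos fun x y h h' => by
    induction x using ind with | _ a b
    induction y using ind with | _ c d
    have e : ∀ a b : M, (0 : DiffRing M) < mk a b ↔ b < a := fun a b => by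
      rw [← not_le, ← not_le, zero_def, mk_le, add_zero, zero_add]
    rw [mul_mk, e]
    rw [e] at h h'
    exact mul_add_mul_lt_mul_add_mul' h h'

/-- The embedding of an ordered semiring in its ring of differences. -/
@[coe] def of (a : M) : DiffRing M := mk a 0

instance : Coe M (DiffRing M) := ⟨of⟩

@[norm_cast] lemma coe_le {a b : M} : (a : DiffRing M) ≤ b ↔ a ≤ b := by simp [of, mk_le]
@[norm_cast] lemma coe_lt {a b : M} : (a : DiffRing M) < b ↔ a < b := by
  rw [← not_le, ← not_le, coe_le]
@[norm_cast] lemma coe_inj {a b : M} : (a : DiffRing M) = b ↔ a = b := by simp [of, mk_eq]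
@[norm_cast] lemma coe_add (a b : M) : ((a + b : M) : DiffRing M) = a + b := by simp [of, add_mk]
@[norm_cast] lemma coe_mul (a b : M) : ((a * b : M) : DiffRing M) = a * b := by simp [of, mul_mk]
@[norm_cast] lemma coe_zero : ((0 : M) : DiffRing M) = 0 := rfl
@[norm_cast] lemma coe_one : ((1 : M) : DiffRing M) = 1 := rfl
@[norm_cast] lemma coe_natCast (n : ℕ) : ((n : M) : DiffRing M) = n := by
  induction n with
  | zero => simp [coe_zero]
  | succ n ih => push_cast [coe_add, coe_one, ih]; rfl
@[norm_cast] lemma coe_ofNat (n : ℕ) [n.AtLeastTwo] :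
    of (ofNat(n) : M) = ofNat(n) := coe_natCast n
lemma coe_nonneg [CanonicallyOrderedAdd M] (a : M) : (0 : DiffRing M) ≤ a := by
  rw [← coe_zero, coe_le]; exact zero_le

end DiffRing

end DiffRing

/-! ### Truth of the formal terms and formulae in a structure. -/

section Realize

variable {M : Type u} [LA.Structure M] {β : Type*} {n : ℕ}

/-- The element `0` of an `LA`-structure. -/
def fzero (M : Type u) [LA.Structure M] : M := Structure.funMap (L := LA) Func.zero ![]
/-- The successor function of an `LA`-structure. -/
def fsucc (a : M) : M := Structure.funMap (L := LA) Func.succ ![a]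
/-- The addition of an `LA`-structure. -/
def fadd (a b : M) : M := Structure.funMap (L := LA) Func.add ![a, b]
/-- The multiplication of an `LA`-structure. -/
def fmul (a b : M) : M := Structure.funMap (L := LA) Func.mul ![a, b]

@[simp] lemma realize_zero (v : β → M) : (0 : LA.Term β).realize v = fzero M :=
  (Term.realize_constants (L := LA) (c := Func.zero)).trans
    (congrArg (Structure.funMap (L := LA) Func.zero) (Subsingleton.elim _ _))

@[simp] lemma realize_S (t : LA.Term β) (v : β → M) : (S t).realize v = fsucc (t.realize v) :=
  Term.realize_functions_apply₁

@[simp] lemma realize_one (v : β → M) : (1 : LA.Term β).realize v = fsucc (fzero M) :=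
  (realize_S _ _).trans (by rw [realize_zero])

@[simp] lemma realize_add (t s : LA.Term β) (v : β → M) :
    (t + s).realize v = fadd (t.realize v) (s.realize v) :=
  Term.realize_functions_apply₂

@[simp] lemma realize_mul (t s : LA.Term β) (v : β → M) :
    (t * s).realize v = fmul (t.realize v) (s.realize v) :=
  Term.realize_functions_apply₂

@[simp] lemma realize_lt (t s : LA.Term (β ⊕ Fin n)) (v : β → M) (xs : Fin n → M) :
    (lt t s).Realize v xs ↔ Lt (t.realize (Sum.elim v xs)) (s.realize (Sum.elim v xs)) :=
  BoundedFormula.realize_rel₂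

@[simp] lemma realize_wk (t : LA.Term (β ⊕ Fin n)) (v : β → M) (xs : Fin n → M) (a : M) :
    (wk t).realize (Sum.elim v (Fin.snoc xs a : Fin (n + 1) → M)) =
      t.realize (Sum.elim v xs) := by
  rw [wk, Term.realize_relabel]
  congr 1
  ext i
  cases i <;> simp

@[simp] lemma realize_ballLT (t : LA.Term (β ⊕ Fin n)) (φ : LA.BoundedFormula β (n + 1))
    (v : β → M) (xs : Fin n → M) :
    (ballLT t φ).Realize v xs ↔
      ∀ a, Lt a (t.realize (Sum.elim v xs)) → φ.Realize v (Fin.snoc xs a) := by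
  simp [ballLT]

@[simp] lemma realize_bexLT (t : LA.Term (β ⊕ Fin n)) (φ : LA.BoundedFormula β (n + 1))
    (v : β → M) (xs : Fin n → M) :
    (bexLT t φ).Realize v xs ↔
      ∃ a, Lt a (t.realize (Sum.elim v xs)) ∧ φ.Realize v (Fin.snoc xs a) := by
  simp [bexLT]

@[simp] lemma realize_ren {α β : Type} {n : ℕ} (g : α → β ⊕ Fin n) (φ : LA.Formula α) (v : β → M)
    (xs : Fin n → M) : (ren g φ).Realize v xs ↔ φ.Realize (Sum.elim v xs ∘ g) := by
  rw [ren, BoundedFormula.realize_relabel, Formula.Realize]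
  exact iff_of_eq (congrArg₂ _ rfl (Subsingleton.elim _ _))

lemma realize_app (E : LA.Formula (Fin 2)) (t s : LA.Term (Empty ⊕ Fin n)) (v : Empty → M)
    (xs : Fin n → M) : (app E t s).Realize v xs ↔
      E.Realize ![t.realize (Sum.elim v xs), s.realize (Sum.elim v xs)] := by
  rw [app, realize_ren, Formula.Realize, BoundedFormula.realize_subst, Formula.Realize]
  refine iff_of_eq (congrArg₂ _ (funext fun i => ?_) rfl)
  fin_cases i <;> rfl

lemma realize_close {k : ℕ} (φ : LA.Formula (Fin k)) :
    M ⊨ close φ ↔ ∀ v : Fin k → M, φ.Realize v := by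
  rw [close, Sentence.Realize]
  refine BoundedFormula.realize_alls.trans ?_
  exact forall_congr' fun v => by rw [realize_ren]; rfl

end Realize

/-! ### The axioms of `PA⁻` and `IΔ₀` as statements about a structure. -/

section PA

variable {M : Type u} [LA.Structure M]

/-- The axioms of `PA⁻` for the operations and the order of an `LA`-structure. -/
structure PAFacts (M : Type u) [LA.Structure M] : Prop where
  add_assoc (a b c : M) : fadd (fadd a b) c = fadd a (fadd b c)
  add_comm (a b : M) : fadd a b = fadd b a
  mul_assoc (a b c : M) : fmul (fmul a b) c = fmul a (fmul b c)
  mul_comm (a b : M) : fmul a b = fmul b a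
  mul_add (a b c : M) : fmul a (fadd b c) = fadd (fmul a b) (fmul a c)
  add_zero (a : M) : fadd a (fzero M) = a
  mul_zero (a : M) : fmul a (fzero M) = fzero M
  mul_one (a : M) : fmul a (fsucc (fzero M)) = a
  succ_eq (a : M) : fsucc a = fadd a (fsucc (fzero M))
  lt_trans (a b c : M) : Lt a b → Lt b c → Lt a c
  lt_irrefl (a : M) : ¬Lt a a
  lt_total (a b : M) : Lt a b ∨ a = b ∨ Lt b a
  add_lt_add (a b c : M) : Lt a b → Lt (fadd a c) (fadd b c)
  mul_lt_mul (a b c : M) : Lt (fzero M) c → Lt a b → Lt (fmul a c) (fmul b c)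
  exists_add (a b : M) : Lt a b → ∃ c, fadd a c = b
  zero_lt_one : Lt (fzero M) (fsucc (fzero M))
  discrete (a : M) : Lt (fzero M) a → Lt (fsucc (fzero M)) a ∨ fsucc (fzero M) = a
  nonneg (a : M) : Lt (fzero M) a ∨ fzero M = a

lemma models_PAMinus_iff : M ⊨ PAMinus ↔ PAFacts M := by
  constructor
  · intro h
    have key : ∀ σ, PAMinus σ → M ⊨ σ := fun σ hσ => h.realize_of_mem σ hσ
    constructor
    · simpa [Sentence.Realize, Formula.Realize, Fin.snoc] using key _ PAMinus.add_assoc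
    · simpa [Sentence.Realize, Formula.Realize, Fin.snoc] using key _ PAMinus.add_comm
    · simpa [Sentence.Realize, Formula.Realize, Fin.snoc] using key _ PAMinus.mul_assoc
    · simpa [Sentence.Realize, Formula.Realize, Fin.snoc] using key _ PAMinus.mul_comm
    · simpa [Sentence.Realize, Formula.Realize, Fin.snoc] using key _ PAMinus.mul_add
    · simpa [Sentence.Realize, Formula.Realize, Fin.snoc] using key _ PAMinus.add_zero
    · simpa [Sentence.Realize, Formula.Realize, Fin.snoc] using key _ PAMinus.mul_zero
    · simpa [Sentence.Realize, Formula.Realize, Fin.snoc] using key _ PAMinus.mul_one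
    · simpa [Sentence.Realize, Formula.Realize, Fin.snoc] using key _ PAMinus.succ_eq
    · simpa [Sentence.Realize, Formula.Realize, Fin.snoc] using key _ PAMinus.lt_trans
    · simpa [Sentence.Realize, Formula.Realize, Fin.snoc] using key _ PAMinus.lt_irrefl
    · simpa [Sentence.Realize, Formula.Realize, Fin.snoc] using key _ PAMinus.lt_total
    · simpa [Sentence.Realize, Formula.Realize, Fin.snoc] using key _ PAMinus.add_lt_add
    · simpa [Sentence.Realize, Formula.Realize, Fin.snoc] using key _ PAMinus.mul_lt_mul
    · simpa [Sentence.Realize, Formula.Realize, Fin.snoc] using key _ PAMinus.exists_add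
    · simpa [Sentence.Realize, Formula.Realize, Fin.snoc] using key _ PAMinus.zero_lt_one
    · simpa [Sentence.Realize, Formula.Realize, Fin.snoc] using key _ PAMinus.discrete
    · simpa [Sentence.Realize, Formula.Realize, Fin.snoc] using key _ PAMinus.nonneg
  · intro h
    refine ⟨fun σ hσ => ?_⟩
    cases hσ
    · simpa [Sentence.Realize, Formula.Realize, Fin.snoc] using h.add_assoc
    · simpa [Sentence.Realize, Formula.Realize, Fin.snoc] using h.add_comm
    · simpa [Sentence.Realize, Formula.Realize, Fin.snoc] using h.mul_assoc
    · simpa [Sentence.Realize, Formula.Realize, Fin.snoc] using h.mul_comm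
    · simpa [Sentence.Realize, Formula.Realize, Fin.snoc] using h.mul_add
    · simpa [Sentence.Realize, Formula.Realize, Fin.snoc] using h.add_zero
    · simpa [Sentence.Realize, Formula.Realize, Fin.snoc] using h.mul_zero
    · simpa [Sentence.Realize, Formula.Realize, Fin.snoc] using h.mul_one
    · simpa [Sentence.Realize, Formula.Realize, Fin.snoc] using h.succ_eq
    · simpa [Sentence.Realize, Formula.Realize, Fin.snoc] using h.lt_trans
    · simpa [Sentence.Realize, Formula.Realize, Fin.snoc] using h.lt_irrefl
    · simpa [Sentence.Realize, Formula.Realize, Fin.snoc] using h.lt_total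
    · simpa [Sentence.Realize, Formula.Realize, Fin.snoc] using h.add_lt_add
    · simpa [Sentence.Realize, Formula.Realize, Fin.snoc] using h.mul_lt_mul
    · simpa [Sentence.Realize, Formula.Realize, Fin.snoc] using h.exists_add
    · simpa [Sentence.Realize, Formula.Realize, Fin.snoc] using h.zero_lt_one
    · simpa [Sentence.Realize, Formula.Realize, Fin.snoc] using h.discrete
    · simpa [Sentence.Realize, Formula.Realize, Fin.snoc] using h.nonneg

lemma models_IDelta0_iff : M ⊨ IDelta0 ↔ PAFacts M ∧
    ∀ (k : ℕ) (φ : LA.Formula (Fin k ⊕ Fin 1)), IsDelta0 φ → ∀ p : Fin k → M,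
      φ.Realize (Sum.elim p fun _ => fzero M) →
      (∀ x, φ.Realize (Sum.elim p fun _ => x) → φ.Realize (Sum.elim p fun _ => fsucc x)) →
      ∀ x, φ.Realize (Sum.elim p fun _ => x) := by
  have key : ∀ (k : ℕ) (φ : LA.Formula (Fin k ⊕ Fin 1)), M ⊨ inductionAxiom φ ↔
      ∀ p : Fin k → M, φ.Realize (Sum.elim p fun _ => fzero M) →
      (∀ x, φ.Realize (Sum.elim p fun _ => x) → φ.Realize (Sum.elim p fun _ => fsucc x)) →
      ∀ x, φ.Realize (Sum.elim p fun _ => x) := by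
    intro k φ
    rw [inductionAxiom, realize_close]
    refine forall_congr' fun p => ?_
    have e : ∀ x : M, (Sum.elim p (Fin.snoc default x : Fin 1 → M)) = Sum.elim p fun _ => x := by
      intro x; ext i; rcases i with i | i
      · rfl
      · obtain rfl : i = Fin.last 0 := Subsingleton.elim (α := Fin 1) _ _
        exact Fin.snoc_last (α := fun _ => M) _ _
    have e₀ : (fun i => (Sum.elim Term.var (fun _ => 0) i : LA.Term (Fin k)).realize p) =
        Sum.elim p fun _ : Fin 1 => fzero M := by
      ext i; rcases i with i | i <;> simp
    have e₁ : ∀ x : M, (fun i => (Sum.elim (fun i => Term.var (Sum.inl i))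
        (fun i => S (Term.var (Sum.inr i))) i : LA.Term (Fin k ⊕ Fin 1)).realize
          (Sum.elim p fun _ => x)) = Sum.elim p fun _ : Fin 1 => fsucc x := by
      intro x; ext i; rcases i with i | i <;> simp
    simp only [Formula.Realize, BoundedFormula.realize_imp, BoundedFormula.realize_inf,
      BoundedFormula.realize_all, realize_ren, Function.comp_id, e, BoundedFormula.realize_subst,
      e₀, e₁, and_imp]
  rw [IDelta0, Theory.model_union_iff, models_PAMinus_iff, Theory.model_iff]
  refine and_congr_right fun _ => ⟨fun h k φ hφ => (key k φ).1 (h _ ⟨k, φ, hφ, rfl⟩), ?_⟩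
  rintro h _ ⟨k, φ, hφ, rfl⟩
  exact (key k φ).2 (h k φ hφ)

end PA

/-! ### Stability of `Δ₀` under renaming and substitution. -/

section Substitution

variable {α β : Type*}

namespace IsDelta0

variable {n : ℕ} {φ ψ : LA.BoundedFormula α n}

lemma not (h : IsDelta0 φ) : IsDelta0 φ.not := .imp h .falsum
lemma and (h : IsDelta0 φ) (h' : IsDelta0 ψ) : IsDelta0 (φ ⊓ ψ) := (h.imp h'.not).not
lemma or (h : IsDelta0 φ) (h' : IsDelta0 ψ) : IsDelta0 (φ ⊔ ψ) := h.not.imp h'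

end IsDelta0

lemma relabel_lt {n k : ℕ} (g : α → β ⊕ Fin n) (t s : LA.Term (α ⊕ Fin k)) :
    (lt t s).relabel g = lt (t.relabel (BoundedFormula.relabelAux g k))
      (s.relabel (BoundedFormula.relabelAux g k)) := by
  refine congrArg (BoundedFormula.rel _) (funext fun i => ?_)
  fin_cases i <;> rfl

/-- A bounded quantifier keeps its shape under renaming only if the renamed bound is still a
weakening, that is, still omits the quantified variable. -/
lemma relabel_wk {n k : ℕ} (g : α → β ⊕ Fin n) (t : LA.Term (α ⊕ Fin k)) :
    (wk t).relabel (BoundedFormula.relabelAux g (k + 1)) =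
      wk (t.relabel (BoundedFormula.relabelAux g k)) := by
  rw [wk, wk, Term.relabel_relabel, Term.relabel_relabel]
  congr 1
  ext i
  rcases i with i | i
  · simp only [BoundedFormula.relabelAux, Function.comp, Sum.map_inl, id]
    rcases g i with j | j
    · simp
    · simp
      rfl
  · simp [BoundedFormula.relabelAux]

lemma relabel_last {n k : ℕ} (g : α → β ⊕ Fin n) :
    (&(Fin.last k) : LA.Term (α ⊕ Fin (k + 1))).relabel (BoundedFormula.relabelAux g (k + 1)) =
      &(Fin.last (n + k)) := by
  simp [BoundedFormula.relabelAux]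

lemma relabel_inf {n k : ℕ} (g : α → β ⊕ Fin n) (φ ψ : LA.BoundedFormula α k) :
    (φ ⊓ ψ).relabel g = φ.relabel g ⊓ ψ.relabel g := rfl

theorem IsDelta0.relabel {n k : ℕ} {φ : LA.BoundedFormula α k} (h : IsDelta0 φ)
    (g : α → β ⊕ Fin n) : IsDelta0 (φ.relabel g) := by
  induction h with
  | falsum => exact .falsum
  | equal t s => exact .equal _ _
  | rel R ts => exact .rel _ _
  | imp _ _ ih₁ ih₂ => exact .imp ih₁ ih₂
  | ball t _ ih =>
    rw [ballLT, BoundedFormula.relabel_all, BoundedFormula.relabel_imp, relabel_lt, relabel_wk,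
      relabel_last]
    exact .ball _ ih
  | bex t _ ih =>
    rw [bexLT, BoundedFormula.relabel_ex, relabel_inf, relabel_lt, relabel_wk, relabel_last]
    exact .bex _ ih

/-- The substitution induced on terms by a substitution in a formula. -/
def substAux (f : α → LA.Term β) (k : ℕ) : α ⊕ Fin k → LA.Term (β ⊕ Fin k) :=
  Sum.elim (Term.relabel Sum.inl ∘ f) (Term.var ∘ Sum.inr)

lemma subst_lt {k : ℕ} (f : α → LA.Term β) (t s : LA.Term (α ⊕ Fin k)) :
    (lt t s).subst f = lt (t.subst (substAux f k)) (s.subst (substAux f k)) := by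
  refine congrArg (BoundedFormula.rel _) (funext fun i => ?_)
  fin_cases i <;> rfl

lemma subst_wk {k : ℕ} (f : α → LA.Term β) (t : LA.Term (α ⊕ Fin k)) :
    (wk t).subst (substAux f (k + 1)) = wk (t.subst (substAux f k)) := by
  induction t with
  | var i =>
    rcases i with i | i
    · simp [wk, substAux]
      rfl
    · rfl
  | func F ts ih => exact congrArg (Term.func F) (funext ih)

theorem IsDelta0.subst {k : ℕ} {φ : LA.BoundedFormula α k} (h : IsDelta0 φ)
    (f : α → LA.Term β) : IsDelta0 (φ.subst f) := by
  induction h with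
  | falsum => exact .falsum
  | equal t s => exact .equal _ _
  | rel R ts => exact .rel _ _
  | imp _ _ ih₁ ih₂ => exact .imp ih₁ ih₂
  | ball t _ ih =>
    change IsDelta0 ((lt _ _).subst f ⟹ _).all
    rw [subst_lt, subst_wk]
    exact .ball _ ih
  | bex t _ ih =>
    change IsDelta0 ((lt _ _).subst f ⊓ _).ex
    rw [subst_lt, subst_wk]
    exact .bex _ ih

/-- Lets a formula with all elements of a model available as parameters be cut down to the finitely
many parameters that occur in it. -/
lemma realize_congr_freeVar {M : Type*} [LA.Structure M] [DecidableEq α] {n : ℕ}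
    (φ : LA.BoundedFormula α n) {v w : α → M} (xs : Fin n → M)
    (h : ∀ a ∈ φ.freeVarFinset, v a = w a) : φ.Realize v xs ↔ φ.Realize w xs := by
  rw [← BoundedFormula.realize_restrictFreeVar (f := Subtype.val) (v := v) v fun _ => rfl,
    BoundedFormula.realize_restrictFreeVar (f := Subtype.val) (v := v) w fun a => h a a.2]

end Substitution

/-! ### Models of `IΔ₀` as canonically ordered commutative semirings. -/

/-- A model of `IΔ₀`. -/
structure Mod where
  carrier : Type u
  [str : LA.Structure carrier]
  models : carrier ⊨ IDelta0

namespace Mod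

instance : CoeSort Mod.{u} (Type u) := ⟨carrier⟩

variable (M : Mod.{u})

instance : LA.Structure M := M.str

lemma facts : PAFacts M := (models_IDelta0_iff.1 M.models).1

instance : Zero M := ⟨fzero M⟩
instance : One M := ⟨fsucc (fzero M)⟩
instance : Add M := ⟨fadd⟩
instance : Mul M := ⟨fmul⟩

lemma fzero_eq : fzero M = 0 := rfl
lemma fadd_eq (a b : M) : fadd a b = a + b := rfl
lemma fsucc_eq (a : M) : fsucc a = a + 1 := M.facts.succ_eq a

instance : CommSemiring M where
  add_assoc := M.facts.add_assoc
  add_comm := M.facts.add_comm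
  add_zero := M.facts.add_zero
  zero_add a := (M.facts.add_comm _ _).trans (M.facts.add_zero a)
  mul_assoc := M.facts.mul_assoc
  mul_comm := M.facts.mul_comm
  mul_zero := M.facts.mul_zero
  zero_mul a := (M.facts.mul_comm _ _).trans (M.facts.mul_zero a)
  mul_one := M.facts.mul_one
  one_mul a := (M.facts.mul_comm _ _).trans (M.facts.mul_one a)
  left_distrib := M.facts.mul_add
  right_distrib a b c := (M.facts.mul_comm _ _).trans <| (M.facts.mul_add _ _ _).trans <|
    congrArg₂ _ (M.facts.mul_comm _ _) (M.facts.mul_comm _ _)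
  nsmul := nsmulRec

noncomputable instance : LinearOrder M where
  le a b := Lt a b ∨ a = b
  lt := Lt
  le_refl a := .inr rfl
  le_trans a b c h h' := by
    rcases h with h | rfl
    · rcases h' with h' | rfl
      · exact .inl (M.facts.lt_trans _ _ _ h h')
      · exact .inl h
    · exact h'
  lt_iff_le_not_ge a b := by
    refine ⟨fun h => ⟨.inl h, ?_⟩, ?_⟩
    · rintro (h' | rfl)
      · exact M.facts.lt_irrefl _ (M.facts.lt_trans _ _ _ h h')
      · exact M.facts.lt_irrefl _ h
    · rintro ⟨h | rfl, h'⟩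
      · exact h
      · exact (h' (.inr rfl)).elim
  le_antisymm a b h h' := by
    rcases h with h | rfl
    · rcases h' with h' | rfl
      · exact (M.facts.lt_irrefl _ (M.facts.lt_trans _ _ _ h h')).elim
      · rfl
    · rfl
  le_total a b := by
    rcases M.facts.lt_total a b with h | h | h
    · exact .inl (.inl h)
    · exact .inl (.inr h)
    · exact .inr (.inl h)
  toDecidableLE := Classical.decRel _

instance : IsOrderedCancelAddMonoid M where
  add_le_add_left a b h c := by
    rcases h with h | rfl
    · exact .inl (M.facts.add_lt_add _ _ _ h)
    · exact le_rfl
  le_of_add_le_add_left a b c h := by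
    by_contra h'
    have := M.facts.add_lt_add _ _ a (lt_of_not_ge h')
    rw [fadd_eq, fadd_eq, add_comm, add_comm b] at this
    exact not_lt_of_ge h this

instance : IsStrictOrderedRing M where
  zero_le_one := .inl M.facts.zero_lt_one
  exists_pair_ne := ⟨0, 1, ne_of_lt M.facts.zero_lt_one⟩
  mul_lt_mul_of_pos_left a ha b c h := by
    rw [mul_comm a, mul_comm a]
    exact M.facts.mul_lt_mul _ _ _ ha h
  mul_lt_mul_of_pos_right a ha b c h := M.facts.mul_lt_mul _ _ _ ha h

instance : CanonicallyOrderedAdd M where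
  exists_add_of_le {a b} h := by
    rcases h with h | rfl
    · obtain ⟨c, hc⟩ := M.facts.exists_add _ _ h
      exact ⟨c, hc.symm⟩
    · exact ⟨0, (add_zero _).symm⟩
  le_add_self a b := by
    have : (0 : M) ≤ b := M.facts.nonneg b
    exact le_add_of_nonneg_left this
  le_self_add a b := by
    have : (0 : M) ≤ b := M.facts.nonneg b
    exact le_add_of_nonneg_right this

variable {M}

lemma add_one_le {a b : M} : a + 1 ≤ b ↔ a < b := by
  refine ⟨fun h => lt_of_lt_of_le (lt_add_of_pos_right _ zero_lt_one) h, fun h => ?_⟩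
  obtain ⟨c, rfl⟩ := exists_add_of_le h.le
  have hc : 0 < c := pos_of_lt_add_right h
  have : 1 ≤ c := (M.facts.discrete c hc)
  gcongr

lemma lt_add_one {a b : M} : a < b + 1 ↔ a ≤ b := by
  rw [← add_one_le, add_le_add_iff_right]

end Mod

/-! ### Calculus of `Δ₀`-definable relations, uniform over a family of models. -/

section Definable

variable {I : Type*} {𝓜 : I → Mod.{u}} {Γ : Type*} {ρ : ∀ i, Γ → 𝓜 i} {α β : Type*}

/-- A family of functions on the models `𝓜 i` given by a term, in which the elements `ρ i c` may
occur as parameters. -/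
def Tm (ρ : ∀ i, Γ → 𝓜 i) (f : ∀ i, (α → 𝓜 i) → 𝓜 i) : Prop :=
  ∃ t : LA.Term (Γ ⊕ α), ∀ i v, t.realize (Sum.elim (ρ i) v) = f i v

/-- A family of relations on the models `𝓜 i` given by a `Δ₀`-formula, in which the elements
`ρ i c` may occur as parameters. -/
def Def (ρ : ∀ i, Γ → 𝓜 i) (P : ∀ i, (α → 𝓜 i) → Prop) : Prop :=
  ∃ φ : LA.Formula (Γ ⊕ α), IsDelta0 φ ∧ ∀ i v, φ.Realize (Sum.elim (ρ i) v) ↔ P i v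

namespace Tm

lemma var (a : α) : Tm ρ fun _ v => v a := ⟨Term.var (Sum.inr a), fun _ _ => rfl⟩

lemma cst (c : Γ) : Tm ρ (α := α) fun i _ => ρ i c := ⟨Term.var (Sum.inl c), fun _ _ => rfl⟩

lemma zero : Tm ρ (α := α) fun _ _ => 0 := ⟨0, fun _ _ => realize_zero _⟩

lemma one : Tm ρ (α := α) fun _ _ => 1 := ⟨1, fun _ _ => realize_one _⟩

variable {f g : ∀ i, (α → 𝓜 i) → 𝓜 i}

lemma add (hf : Tm ρ f) (hg : Tm ρ g) : Tm ρ fun i v => f i v + g i v := by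
  obtain ⟨t, ht⟩ := hf
  obtain ⟨s, hs⟩ := hg
  exact ⟨t + s, fun i v => by rw [realize_add, ht, hs]; rfl⟩

lemma mul (hf : Tm ρ f) (hg : Tm ρ g) : Tm ρ fun i v => f i v * g i v := by
  obtain ⟨t, ht⟩ := hf
  obtain ⟨s, hs⟩ := hg
  exact ⟨t * s, fun i v => by rw [realize_mul, ht, hs]; rfl⟩

lemma natCast (n : ℕ) : Tm ρ (α := α) fun _ _ => n := by
  induction n with
  | zero => simpa using zero
  | succ n ih => simpa using ih.add one

lemma ofNat (n : ℕ) [n.AtLeastTwo] : Tm ρ (α := α) fun _ _ => ofNat(n) := by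
  exact natCast n

lemma pow (hf : Tm ρ f) (n : ℕ) : Tm ρ fun i v => f i v ^ n := by
  induction n with
  | zero => simpa using one
  | succ n ih => simpa [pow_succ] using ih.mul hf

end Tm

namespace Def

variable {P Q : ∀ i, (α → 𝓜 i) → Prop} {f g : ∀ i, (α → 𝓜 i) → 𝓜 i}

lemma of_iff (h : Def ρ P) (e : ∀ i v, Q i v ↔ P i v) : Def ρ Q := by
  obtain ⟨φ, hφ, h⟩ := h
  exact ⟨φ, hφ, fun i v => (h i v).trans (e i v).symm⟩

lemma eq (hf : Tm ρ f) (hg : Tm ρ g) : Def ρ fun i v => f i v = g i v := by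
  obtain ⟨t, ht⟩ := hf
  obtain ⟨s, hs⟩ := hg
  refine ⟨(t.relabel Sum.inl).bdEqual (s.relabel Sum.inl), .equal _ _, fun i v => ?_⟩
  rw [Formula.Realize, BoundedFormula.realize_bdEqual, Term.realize_relabel, Term.realize_relabel,
    Sum.elim_comp_inl, ht, hs]

lemma lt (hf : Tm ρ f) (hg : Tm ρ g) : Def ρ fun i v => f i v < g i v := by
  obtain ⟨t, ht⟩ := hf
  obtain ⟨s, hs⟩ := hg
  refine ⟨Arith.lt (t.relabel Sum.inl) (s.relabel Sum.inl), .rel _ _, fun i v => ?_⟩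
  rw [Formula.Realize, realize_lt, Term.realize_relabel, Term.realize_relabel,
    Sum.elim_comp_inl, ht, hs]
  rfl

lemma not (h : Def ρ P) : Def ρ fun i v => ¬P i v := by
  obtain ⟨φ, hφ, h⟩ := h
  exact ⟨_, hφ.not, fun i v => Formula.realize_not.trans (not_congr (h i v))⟩

lemma imp (h : Def ρ P) (h' : Def ρ Q) : Def ρ fun i v => P i v → Q i v := by
  obtain ⟨φ, hφ, h⟩ := h
  obtain ⟨ψ, hψ, h'⟩ := h'
  exact ⟨_, hφ.imp hψ, fun i v => Formula.realize_imp.trans (imp_congr (h i v) (h' i v))⟩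

lemma and (h : Def ρ P) (h' : Def ρ Q) : Def ρ fun i v => P i v ∧ Q i v :=
  ((h.imp h'.not).not).of_iff fun _ _ => by tauto

lemma or (h : Def ρ P) (h' : Def ρ Q) : Def ρ fun i v => P i v ∨ Q i v :=
  (h.not.imp h').of_iff fun _ _ => by tauto

lemma le (hf : Tm ρ f) (hg : Tm ρ g) : Def ρ fun i v => f i v ≤ g i v :=
  (lt hg hf).not.of_iff fun _ _ => by rw [not_lt]

lemma ne (hf : Tm ρ f) (hg : Tm ρ g) : Def ρ fun i v => f i v ≠ g i v := (eq hf hg).not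

lemma bexLT {Q : ∀ i, (α → 𝓜 i) → 𝓜 i → Prop} (hf : Tm ρ f)
    (h : Def ρ (α := Option α) fun i w => Q i (fun a => w (some a)) (w none)) :
    Def ρ fun i v => ∃ x < f i v, Q i v x := by
  obtain ⟨t, ht⟩ := hf
  obtain ⟨φ, hφ, h⟩ := h
  -- The variable `none` becomes the bound variable; parameters and the variables `some a` stay
  -- free.
  let r : Γ ⊕ Option α → (Γ ⊕ α) ⊕ Fin 1 :=
    Sum.elim (Sum.inl ∘ Sum.inl) (fun a => a.elim (Sum.inr 0) (Sum.inl ∘ Sum.inr))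
  refine ⟨Arith.bexLT (n := 0) (t.relabel Sum.inl) (BoundedFormula.relabel (n := 1) (k := 0) r φ),
    .bex _ (hφ.relabel r),
    fun i v => ?_⟩
  rw [Formula.Realize, realize_bexLT, Term.realize_relabel, Sum.elim_comp_inl, ht]
  refine exists_congr fun x => and_congr_right fun _ => ?_
  have hw : φ.Realize (Sum.elim (ρ i) fun a => a.elim x v) ↔ Q i v x := h i fun a => a.elim x v
  rw [← hw]
  refine (BoundedFormula.realize_relabel (m := 1) (n := 0)).trans ?_
  refine iff_of_eq (congrArg₂ _ (funext fun a => ?_) (Subsingleton.elim _ _))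
  rcases a with a | _ | a
  · rfl
  · exact Fin.snoc_last (n := 0) (α := fun _ => 𝓜 i) x default
  · rfl

lemma ballLT {Q : ∀ i, (α → 𝓜 i) → 𝓜 i → Prop} (hf : Tm ρ f)
    (h : Def ρ (α := Option α) fun i w => Q i (fun a => w (some a)) (w none)) :
    Def ρ fun i v => ∀ x < f i v, Q i v x :=
  (bexLT hf (Q := fun i v x => ¬Q i v x) h.not).not.of_iff fun _ _ => by push Not; rfl

lemma bexLE {Q : ∀ i, (α → 𝓜 i) → 𝓜 i → Prop} (hf : Tm ρ f)
    (h : Def ρ (α := Option α) fun i w => Q i (fun a => w (some a)) (w none)) :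
    Def ρ fun i v => ∃ x ≤ f i v, Q i v x :=
  (bexLT (hf.add .one) h).of_iff fun _ _ => by simp only [Mod.lt_add_one]

lemma ballLE {Q : ∀ i, (α → 𝓜 i) → 𝓜 i → Prop} (hf : Tm ρ f)
    (h : Def ρ (α := Option α) fun i w => Q i (fun a => w (some a)) (w none)) :
    Def ρ fun i v => ∀ x ≤ f i v, Q i v x :=
  (ballLT (hf.add .one) h).of_iff fun _ _ => by simp only [Mod.lt_add_one]

/-- Substitution of terms in a `Δ₀`-formula. -/
lemma subst {R : ∀ i, (β → 𝓜 i) → Prop} (h : Def ρ R) {F : β → ∀ i, (α → 𝓜 i) → 𝓜 i}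
    (hF : ∀ b, Tm ρ (F b)) : Def ρ fun i v => R i fun b => F b i v := by
  choose t ht using hF
  obtain ⟨φ, hφ, h⟩ := h
  refine ⟨φ.subst (Sum.elim (fun c => Term.var (Sum.inl c)) t), hφ.subst _, fun i v => ?_⟩
  refine Iff.trans ?_ (h i fun b => F b i v)
  rw [Formula.Realize, BoundedFormula.realize_subst]
  refine iff_of_eq (congrArg₂ _ (funext fun a => ?_) rfl)
  rcases a with a | a
  · rfl
  · exact ht _ _ _

lemma of_formula {E : LA.Formula β} (hE : IsDelta0 E) {F : β → ∀ i, (α → 𝓜 i) → 𝓜 i}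
    (hF : ∀ b, Tm ρ (F b)) : Def ρ fun i v => E.Realize fun b => F b i v := by
  refine subst (R := fun i v => E.Realize v) ?_ hF
  exact ⟨_, hE.subst fun b => Term.var (Sum.inr b), fun i v => BoundedFormula.realize_subst⟩

lemma dvd (hf : Tm ρ f) (hg : Tm ρ g) : Def ρ fun i v => f i v ∣ g i v := by
  have : Def ρ (α := Fin 2) fun i v => ∃ c ≤ v 1, v 1 = v 0 * c :=
    bexLE (.var 1) (eq (.var (some 1)) (.mul (.var (some 0)) (.var none)))
  refine (this.subst (F := ![f, g]) (by simp [Fin.forall_fin_two, hf, hg])).of_iff fun i v => ?_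
  change f i v ∣ g i v ↔ ∃ c ≤ g i v, g i v = f i v * c
  refine ⟨?_, fun ⟨c, _, h⟩ => ⟨c, h⟩⟩
  rintro ⟨c, h⟩
  -- The cofactor is at most the dividend, except that division by `0` leaves it arbitrary; then `0`
  -- serves.
  rcases eq_or_ne (f i v) 0 with h0 | h0
  · exact ⟨0, zero_le, by rw [h, h0, zero_mul, zero_mul]⟩
  · have : 1 ≤ f i v := by rw [← zero_add 1, Mod.add_one_le]; exact pos_iff_ne_zero.2 h0
    exact ⟨c, h ▸ le_mul_of_one_le_left zero_le this, h⟩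

end Def

end Definable

/-! ### `Δ₀`-induction, the least number principle and division with remainder. -/

namespace Mod

variable {M : Mod.{u}} {p : M → Prop}

/-- `Δ₀`-definability with parameters of a set of elements of a model. -/
abbrev D0 (p : M → Prop) : Prop :=
  Def (I := Unit) (𝓜 := fun _ => M) (fun _ c => c) (α := Unit) fun _ v => p (v ())

theorem D0.induction (hp : D0 p) (h0 : p 0) (hs : ∀ x, p x → p (x + 1)) (x : M) : p x := by
  classical
  obtain ⟨φ, hφ, h⟩ := hp
  simp only [forall_const] at h
  -- The induction axioms allow a finite tuple of parameters, so the elements occurring in `φ` are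
  -- enumerated; the others may be replaced by `0`.
  let s : Finset M := φ.freeVarFinset.preimage Sum.inl Sum.inl_injective.injOn
  let g : M ⊕ Unit → LA.Term (Fin s.card ⊕ Fin 1) :=
    Sum.elim (fun c => if h : c ∈ s then Term.var (Sum.inl (s.equivFin ⟨c, h⟩)) else 0)
      fun _ => Term.var (Sum.inr 0)
  have key : ∀ y, (φ.subst g).Realize (Sum.elim (fun i => (s.equivFin.symm i : M)) fun _ => y)
      default ↔ p y := by
    intro y
    rw [BoundedFormula.realize_subst]
    refine Iff.trans ?_ (h fun _ => y)
    refine realize_congr_freeVar _ _ fun a ha => ?_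
    rcases a with c | _
    · have hc : c ∈ s := by simpa [s] using ha
      simp [g, hc]
    · rfl
  have := (models_IDelta0_iff.1 M.models).2 _ (φ.subst g) (hφ.subst g)
    (fun i => (s.equivFin.symm i : M))
  simp only [Formula.Realize, key, fsucc_eq, fzero_eq] at this
  exact this h0 hs x

theorem D0.least (hp : D0 p) {x : M} (hx : p x) : ∃ x, p x ∧ ∀ y < x, ¬p y := by
  by_contra! hc
  have : D0 fun x => ∀ y < x, ¬p y :=
    .ballLT (.var ()) (Def.not (hp.subst (F := fun _ _ w => w none) fun _ => .var none))
  have := this.induction (fun y hy => (not_lt_zero hy).elim) (fun x ih y hy hpy => by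
    obtain ⟨z, hz, hpz⟩ := hc y hpy
    exact ih z (lt_of_lt_of_le hz (lt_add_one.1 hy)) hpz)
  exact this (x + 1) x (lt_add_one.2 le_rfl) hx

theorem D0.strong_induction (hp : D0 p) (h : ∀ x, (∀ y < x, p y) → p x) (x : M) : p x := by
  by_contra hx
  obtain ⟨y, hy, hm⟩ := D0.least (p := fun x => ¬p x) hp.not hx
  exact hy (h y fun z hz => not_not.1 (hm z hz))

variable {M : Mod.{u}} {a b c d m n r x y z : M}

lemma one_le_iff : 1 ≤ a ↔ 0 < a := by rw [← zero_add 1, add_one_le]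

lemma le_of_dvd (h : a ∣ b) (hb : 0 < b) : a ≤ b := by
  obtain ⟨c, rfl⟩ := h
  exact le_mul_of_one_le_right zero_le (one_le_iff.2 (pos_of_mul_pos_right hb zero_le))

lemma pos_of_dvd (h : a ∣ b) (hb : 0 < b) : 0 < a := by
  obtain ⟨c, rfl⟩ := h
  exact pos_of_mul_pos_left hb zero_le

lemma exists_eq_add_one (h : a ≠ 0) : ∃ b, a = b + 1 := by
  obtain ⟨c, hc⟩ := exists_add_of_le (one_le_iff.2 (pos_iff_ne_zero.2 h))
  exact ⟨c, by rw [hc, add_comm]⟩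

lemma exists_div (hb : 0 < b) (a : M) : ∃ q ≤ a, ∃ r < b, a = b * q + r := by
  have hp : D0 fun a => ∃ q ≤ a, ∃ r < b, a = b * q + r := by
    refine .bexLE (.var _) (.bexLT (.cst b) (.eq (.var _) (.add (.mul (.cst b) (.var _)) (.var _))))
  refine hp.induction ⟨0, le_rfl, 0, hb, by simp⟩ ?_ a
  rintro a ⟨q, hq, r, hr, rfl⟩
  rcases lt_or_eq_of_le (add_one_le.2 hr) with h | h
  · exact ⟨q, hq.trans (lt_add_one.2 le_rfl).le, r + 1, h, by ring⟩
  · exact ⟨q + 1, by gcongr, 0, hb, by rw [mul_add, add_assoc, h]; ring⟩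

lemma div_unique {q q' r' : M} (hr : r < b) (hr' : r' < b) (h : b * q + r = b * q' + r') :
    q = q' ∧ r = r' := by
  have key : ∀ {q q' r r' : M}, r' < b → b * q + r = b * q' + r' → ¬q' < q := by
    intro q q' r r' hr h hq
    obtain ⟨s, rfl⟩ := exists_add_of_le (add_one_le.2 hq)
    have : r' = b + (b * s + r) := by
      apply add_left_cancel (a := b * q')
      rw [← h]; ring
    exact not_le_of_gt hr (this ▸ le_self_add)
  have hq : q = q' := le_antisymm (not_lt.1 (key hr' h)) (not_lt.1 (key hr h.symm))
  subst hq
  exact ⟨rfl, add_left_cancel h⟩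

lemma two_mul_ne (a b : M) : 2 * a ≠ 2 * b + 1 := by
  intro h
  have := (div_unique (q := a) (q' := b) (r := 0) (r' := 1) (b := 2) (by simp) (by simp)
    (by simpa using h)).2
  simp at this

lemma even_or_odd (a : M) : ∃ b, a = 2 * b ∨ a = 2 * b + 1 := by
  obtain ⟨q, -, r, hr, rfl⟩ := exists_div (b := 2) (by simp) a
  refine ⟨q, ?_⟩
  rw [← one_add_one_eq_two, lt_add_one] at hr
  rcases hr.lt_or_eq with h | h
  · left
    rw [← one_add_one_eq_two, ← not_le, one_le_iff, not_lt, nonpos_iff_eq_zero] at *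
    simp [h]
  · right; rw [h]

/-! ### Powers of two, defined through their divisors. -/

/-- The powers of two: those elements all of whose divisors other than `1` are even. -/
def Pow2 (a : M) : Prop := 0 < a ∧ ∀ d, d ∣ a → d = 1 ∨ 2 ∣ d

lemma Pow2.pos (h : Pow2 a) : 0 < a := h.1

lemma Pow2.of_dvd (h : Pow2 a) (hd : d ∣ a) : Pow2 d :=
  ⟨pos_of_dvd hd h.1, fun _ he => h.2 _ (he.trans hd)⟩

lemma pow2_one : Pow2 (1 : M) := by
  refine ⟨one_pos, fun d hd => .inl (le_antisymm (le_of_dvd hd one_pos) ?_)⟩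
  exact one_le_iff.2 (pos_of_dvd hd one_pos)

lemma Pow2.double (h : Pow2 a) : Pow2 (2 * a) := by
  refine ⟨mul_pos two_pos h.1, ?_⟩
  rintro d ⟨c, hc⟩
  obtain ⟨e, rfl | rfl⟩ := even_or_odd d
  · exact .inr (dvd_mul_right _ _)
  -- An odd divisor of `2 * a` has an even cofactor and so divides `a`.
  · obtain ⟨f, rfl | rfl⟩ := even_or_odd c
    · refine h.2 _ ⟨f, ?_⟩
      apply mul_left_cancel₀ (two_ne_zero (α := M))
      rw [hc]; ring
    · exact (two_mul_ne a (e * (2 * f + 1) + f) (by rw [hc]; ring)).elim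

lemma Pow2.cases (h : Pow2 a) : a = 1 ∨ ∃ b, a = 2 * b ∧ Pow2 b := by
  refine (h.2 a dvd_rfl).imp_right ?_
  rintro ⟨b, rfl⟩
  exact ⟨b, rfl, h.of_dvd (dvd_mul_left _ _)⟩

end Mod

section
variable {I : Type*} {𝓜 : I → Mod.{u}} {Γ : Type*} {ρ : ∀ i, Γ → 𝓜 i} {α : Type*}
  {f g k l : ∀ i, (α → 𝓜 i) → 𝓜 i}

/-- Divisors of a positive element do not exceed it, which bounds the quantifier. Here and below,
definability is first shown for variables and terms are then substituted. -/
lemma Def.pow2 (hf : Tm ρ f) : Def ρ fun i v => Mod.Pow2 (f i v) := by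
  have h : Def ρ (α := Fin 1) fun i v => 0 < v 0 ∧ ∀ d ≤ v 0, d ∣ v 0 → d = 1 ∨ 2 ∣ d :=
    .and (.lt .zero (.var _)) (.ballLE (.var _) (.imp (.dvd (.var _) (.var _))
      (.or (.eq (.var _) .one) (.dvd (.ofNat 2) (.var _)))))
  refine (h.subst (F := fun _ => f) fun _ => hf).of_iff fun i v => ?_
  exact and_congr_right fun h0 => forall_congr' fun d =>
    ⟨fun h _ => h, fun h hd => h (Mod.le_of_dvd hd h0) hd⟩

end

namespace Mod

variable {M : Mod.{u}} {a b c d m n r x y z : M}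

/-- A power of two other than `1` is twice a smaller one, so strong induction applies. -/
theorem pow2_induction {p : M → Prop} (hp : D0 p) (h1 : p 1)
    (hs : ∀ a, Pow2 a → p a → p (2 * a)) (ha : Pow2 a) : p a := by
  refine D0.strong_induction (p := fun a => Pow2 a → p a) (.imp (.pow2 (.var _)) hp) ?_ a ha
  intro a ih ha
  rcases ha.cases with rfl | ⟨b, rfl, hb⟩
  · exact h1
  · exact hs b hb (ih b (lt_mul_of_one_lt_left hb.pos one_lt_two) hb)

lemma Pow2.dvd (ha : Pow2 a) (hb : Pow2 b) (h : a ≤ b) : a ∣ b := by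
  refine pow2_induction (p := fun b => ∀ a ≤ b, Pow2 a → a ∣ b)
    (.ballLE (.var _) (.imp (.pow2 (.var _)) (.dvd (.var _) (.var _)))) ?_ ?_ hb a h ha
  · intro a h ha
    rw [le_antisymm h (one_le_iff.2 ha.pos)]
  · intro b _ ih a h ha
    rcases ha.cases with rfl | ⟨c, rfl, hc⟩
    · exact one_dvd _
    · exact mul_dvd_mul_left _ (ih c (le_of_mul_le_mul_left h two_pos) hc)

lemma Pow2.mul (ha : Pow2 a) (hb : Pow2 b) : Pow2 (a * b) := by
  refine pow2_induction (p := fun a => Pow2 (a * b)) (.pow2 (.mul (.var _) (.cst b))) ?_ ?_ ha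
  · rwa [one_mul]
  · intro a _ h
    rw [mul_assoc]
    exact h.double

lemma Pow2.pow (ha : Pow2 a) (k : ℕ) : Pow2 (a ^ k) := by
  induction k with
  | zero => simpa using pow2_one
  | succ k ih => exact pow_succ a k ▸ ih.mul ha

lemma pow2_two_pow (k : ℕ) : Pow2 ((2 : M) ^ k) :=
  Pow2.pow (by simpa using (pow2_one (M := M)).double) k

lemma Pow2.two_mul_le (ha : Pow2 a) (hb : Pow2 b) (h : a < b) : 2 * a ≤ b := by
  obtain ⟨c, rfl⟩ := ha.dvd hb h.le
  rw [mul_comm]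
  gcongr
  rw [← one_add_one_eq_two, add_one_le]
  exact lt_of_mul_lt_mul_left (by simpa using h) (zero_le (a := a))

lemma exists_pow2 (z : M) : ∃ u, Pow2 u ∧ z < u := by
  -- The bound `2 * z + 1` keeps the statement `Δ₀`; it suffices because `u` is doubled only when `u
  -- = z + 1`.
  have hp : D0 fun z : M => ∃ u ≤ 2 * z + 1, Pow2 u ∧ z < u :=
    .bexLE (.add (.mul (.ofNat 2) (.var _)) .one) (.and (.pow2 (.var _)) (.lt (.var _) (.var _)))
  obtain ⟨u, -, h⟩ := hp.induction ⟨1, by simp, pow2_one, one_pos⟩ (by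
    rintro z ⟨u, hu, hu2, hz⟩
    rcases (add_one_le.2 hz).lt_or_eq with h | rfl
    · exact ⟨u, hu.trans (by gcongr; exact (lt_add_one.2 le_rfl).le), hu2, h⟩
    · exact ⟨_, (lt_add_one.2 le_rfl).le, hu2.double, lt_mul_of_one_lt_left hu2.pos one_lt_two⟩) z
  exact ⟨u, h⟩

/-! ### The definition of exponentiation. -/

variable {M : Mod.{u}} {a b c d k m n r x y z V W R Y Z : M}

/-- `Y` is a power of the power of two `m + 1`, and its exponent is congruent to `n < m` modulo
`m`. -/
def Cnt (m n Y : M) : Prop := Pow2 Y ∧ n < m ∧ ∃ t, Y = 1 + n * m + t * (m * m)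

/-- No power of `m + 1` up to `Z` other than `1` has an exponent divisible by `m`, so that exponents
of powers of `m + 1` up to `Z` are less than `m`. -/
def NoWrap (m Z : M) : Prop := ∀ Y ≤ Z, Pow2 Y → (∃ t, Y = 1 + t * (m * m)) → Y = 1

/-- `R = 2 ^ r`, as witnessed by `R = (2 (m + 1)) ^ r / (m + 1) ^ r` with powers up to `Z`. -/
def SmallExp (Z m r R : M) : Prop :=
  Pow2 R ∧ ∃ V ≤ Z, ∃ W ≤ Z, Cnt m r V ∧ Cnt (2 * m + 1) r W ∧ W = V * R

/-- The base `m + 1` is suitable for computing exponents of powers of two up to `Z`. -/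
def Suitable (m Z : M) : Prop :=
  Pow2 (m + 1) ∧ 31 ≤ m ∧ NoWrap m Z ∧ NoWrap (2 * m + 1) Z ∧
    ∃ k ≤ m, m = 2 * k + 1 ∧ ¬NoWrap k Z

/-- `y = 2 ^ x`, as witnessed by `y = (m + 1) ^ n * 2 ^ r` and `x = d * n + r` with
`m + 1 = 2 ^ d`. -/
def BaseExp (Z m x y : M) : Prop :=
  ∃ Y ≤ y, ∃ R ≤ m, ∃ n < m, ∃ d < m, ∃ r < m,
    y = Y * R ∧ Cnt m n Y ∧ SmallExp Z m d (m + 1) ∧ SmallExp Z m r R ∧ x = d * n + r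

/-- The graph of exponentiation with base `2`. -/
def Exp (x y : M) : Prop :=
  Pow2 y ∧ ∃ m ≤ 2 * (2 ^ 60 * y) + 1, Suitable m (2 ^ 60 * y) ∧ BaseExp (2 ^ 60 * y) m x y

lemma exists_mul_iff (h : 0 < a) {p : M → Prop} (hp : ∀ t, p t → t * a ≤ b) :
    (∃ t, p t) ↔ ∃ t ≤ b, p t :=
  ⟨fun ⟨t, ht⟩ => ⟨t, (le_mul_of_one_le_right zero_le (one_le_iff.2 h)).trans (hp t ht), ht⟩,
    fun ⟨t, _, ht⟩ => ⟨t, ht⟩⟩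

/-- Makes a congruence `Δ₀`: the multiplier is bounded by `a`, and may be taken to be `0` when the
modulus is `0`. -/
lemma exists_eq_add_mul_iff (a b c : M) : (∃ t, a = b + t * c) ↔ ∃ t ≤ a, a = b + t * c := by
  rcases eq_or_ne c 0 with rfl | hc
  · simp only [mul_zero, add_zero, exists_and_right]
    exact ⟨fun ⟨_, h⟩ => ⟨⟨0, zero_le⟩, h⟩, fun ⟨_, h⟩ => ⟨0, h⟩⟩
  · exact exists_mul_iff (pos_iff_ne_zero.2 hc) fun t ht => ht ▸ le_add_self

end Mod

/-! ### The graph of exponentiation is `Δ₀`. -/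

section
variable {I : Type*} {𝓜 : I → Mod.{u}} {Γ : Type*} {ρ : ∀ i, Γ → 𝓜 i} {α : Type*}
  {f g k l : ∀ i, (α → 𝓜 i) → 𝓜 i}

open Arith.Mod

namespace Def

lemma existsAddMul (hf : Tm ρ f) (hg : Tm ρ g) (hk : Tm ρ k) :
    Def ρ fun i v => ∃ t, f i v = g i v + t * k i v := by
  have h : Def ρ (α := Fin 3) fun i v => ∃ t ≤ v 0, v 0 = v 1 + t * v 2 :=
    .bexLE (.var _) (.eq (.var _) (.add (.var _) (.mul (.var _) (.var _))))
  exact (h.subst (F := ![f, g, k]) (by simp [Fin.forall_fin_succ, hf, hg, hk])).of_iff fun i v =>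
    exists_eq_add_mul_iff _ _ _

lemma cnt (hf : Tm ρ f) (hg : Tm ρ g) (hk : Tm ρ k) :
    Def ρ fun i v => Cnt (f i v) (g i v) (k i v) :=
  .and (.pow2 hk) (.and (.lt hg hf)
    (.existsAddMul hk (.add .one (.mul hg hf)) (.mul hf hf)))

lemma noWrap (hf : Tm ρ f) (hg : Tm ρ g) : Def ρ fun i v => NoWrap (f i v) (g i v) := by
  have h : Def ρ (α := Fin 2) fun i v => NoWrap (v 0) (v 1) :=
    .ballLE (.var _) (.imp (.pow2 (.var _)) (.imp
      (.existsAddMul (.var _) .one (.mul (.var _) (.var _))) (.eq (.var _) .one)))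
  exact h.subst (F := ![f, g]) (by simp [Fin.forall_fin_succ, hf, hg])

lemma smallExp (hf : Tm ρ f) (hg : Tm ρ g) (hk : Tm ρ k) (hl : Tm ρ l) :
    Def ρ fun i v => SmallExp (f i v) (g i v) (k i v) (l i v) := by
  have h : Def ρ (α := Fin 4) fun i v => SmallExp (v 0) (v 1) (v 2) (v 3) :=
    .and (.pow2 (.var _)) (.bexLE (.var _) (.bexLE (.var _) (.and
      (.cnt (.var _) (.var _) (.var _)) (.and
      (.cnt (.add (.mul (.ofNat 2) (.var _)) .one) (.var _) (.var _))
      (.eq (.var _) (.mul (.var _) (.var _)))))))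
  exact h.subst (F := ![f, g, k, l]) (by simp [Fin.forall_fin_succ, hf, hg, hk, hl])

lemma suitable (hf : Tm ρ f) (hg : Tm ρ g) : Def ρ fun i v => Suitable (f i v) (g i v) := by
  have h : Def ρ (α := Fin 2) fun i v => Suitable (v 0) (v 1) :=
    .and (.pow2 (.add (.var _) .one)) (.and (.le (.ofNat 31) (.var _)) (.and
      (.noWrap (.var _) (.var _)) (.and
      (.noWrap (.add (.mul (.ofNat 2) (.var _)) .one) (.var _))
      (.bexLE (.var _) (.and (.eq (.var _) (.add (.mul (.ofNat 2) (.var _)) .one))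
      (.not (.noWrap (.var _) (.var _))))))))
  exact h.subst (F := ![f, g]) (by simp [Fin.forall_fin_succ, hf, hg])

lemma baseExp (hf : Tm ρ f) (hg : Tm ρ g) (hk : Tm ρ k) (hl : Tm ρ l) :
    Def ρ fun i v => BaseExp (f i v) (g i v) (k i v) (l i v) := by
  have h : Def ρ (α := Fin 4) fun i v => BaseExp (v 0) (v 1) (v 2) (v 3) :=
    .bexLE (.var _) (.bexLE (.var _) (.bexLT (.var _) (.bexLT (.var _) (.bexLT (.var _) (.and
      (.eq (.var _) (.mul (.var _) (.var _))) (.and (.cnt (.var _) (.var _) (.var _)) (.and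
      (.smallExp (.var _) (.var _) (.var _) (.add (.var _) .one)) (.and
      (.smallExp (.var _) (.var _) (.var _) (.var _))
      (.eq (.var _) (.add (.mul (.var _) (.var _)) (.var _)))))))))))
  exact h.subst (F := ![f, g, k, l]) (by simp [Fin.forall_fin_succ, hf, hg, hk, hl])

lemma exp (hf : Tm ρ f) (hg : Tm ρ g) : Def ρ fun i v => Exp (f i v) (g i v) := by
  have h : Def ρ (α := Fin 2) fun i v => Exp (v 0) (v 1) :=
    .and (.pow2 (.var _)) (.bexLE
      (.add (.mul (.ofNat 2) (.mul (.pow (.ofNat 2) 60) (.var _))) .one) (.and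
      (.suitable (.var _) (.mul (.pow (.ofNat 2) 60) (.var _)))
      (.baseExp (.mul (.pow (.ofNat 2) 60) (.var _)) (.var _) (.var _) (.var _))))
  exact h.subst (F := ![f, g]) (by simp [Fin.forall_fin_succ, hf, hg])

end Def
end

/-! ### Properties of the defined exponentiation. -/

namespace Mod

variable {M : Mod.{u}} {a b c d k m n r x y z V W R Y Z : M}

lemma cnt_one (hm : 0 < m) : Cnt m 0 1 := ⟨pow2_one, hm, 0, by simp⟩

lemma Cnt.pow2 (h : Cnt m n Y) : Pow2 Y := h.1
lemma Cnt.pos (h : Cnt m n Y) : 0 < m := pos_of_gt h.2.1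

lemma Cnt.eq_one (h : Cnt m 0 Y) (hm : NoWrap m Z) (hY : Y ≤ Z) : Y = 1 := by
  obtain ⟨h, -, t, ht⟩ := h
  exact hm Y hY h ⟨t, by simpa using ht⟩

lemma Cnt.eq_zero (h : Cnt m n 1) : n = 0 := by
  obtain ⟨-, hn, t, ht⟩ := h
  have : n * m + t * (m * m) = 0 := by
    apply add_left_cancel (a := 1)
    rw [← add_assoc, ← ht, add_zero]
  simpa [(pos_of_gt hn).ne'] using (add_eq_zero.1 this).1

/-- For `0 < n < m`, the residue `1 + n * m` differs from `1` modulo `m * m`. -/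
lemma Cnt.not_wrap (h : Cnt m n Y) (hn : n ≠ 0) (x : M) : Y ≠ 1 + x * (m * m) := by
  obtain ⟨-, hm, t, rfl⟩ := h
  intro h
  refine hn (div_unique (b := m) (q := t) (q' := x) hm (pos_of_gt hm) ?_).2
  apply mul_left_cancel₀ (pos_of_gt hm).ne'
  apply add_left_cancel (a := 1)
  linear_combination h

lemma Cnt.succ (h : Cnt m n Y) (hm : Pow2 (m + 1)) (hn : n + 1 < m) :
    Cnt m (n + 1) ((m + 1) * Y) := by
  obtain ⟨hY, -, t, rfl⟩ := h
  exact ⟨hm.mul hY, hn, t * (m + 1) + n, by ring⟩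

/-- The exponent `n + 1` can fail to be below `m` only by equalling `m`; then `(m + 1) * Y` would be
`1` modulo `m * m`, which `NoWrap` forbids. -/
lemma Cnt.succ_of_noWrap (h : Cnt m n Y) (hm : Pow2 (m + 1)) (hw : NoWrap m Z)
    (hY : (m + 1) * Y ≤ Z) : Cnt m (n + 1) ((m + 1) * Y) := by
  rcases (add_one_le.2 h.2.1).lt_or_eq with hn | hn
  · exact h.succ hm hn
  · obtain ⟨hY', h0, t, ht⟩ := h
    have := hw _ hY (hm.mul hY') ⟨t * (m + 1) + n + 1, by rw [ht, ← hn]; ring⟩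
    have h1 : m + 1 ≤ 1 := (le_mul_of_one_le_right zero_le (one_le_iff.2 hY'.pos)).trans_eq this
    exact ((pos_of_gt h0).not_ge (by simpa using h1)).elim

lemma Cnt.pred (h : Cnt m (n + 1) Y) (hm : Pow2 (m + 1)) :
    ∃ Y', Y = (m + 1) * Y' ∧ Cnt m n Y' := by
  obtain ⟨hY, hn, t, ht⟩ := h
  have hn' : n < m := (lt_add_one.2 le_rfl).trans hn
  have h1 : 1 < m := lt_of_le_of_lt le_add_self hn
  have hmY : m + 1 ≤ Y := by
    rw [ht]; exact le_iff_exists_add.2 ⟨n * m + t * (m * m), by ring⟩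
  obtain ⟨Y', rfl⟩ := hm.dvd hY hmY
  -- The residue of `Y'` modulo `m * m` is found by dividing by `m` twice: the first remainder is
  -- `1`, the second is `n`.
  obtain ⟨a, -, s, hs, ha⟩ := exists_div (pos_of_gt hn) Y'
  obtain ⟨h2, rfl⟩ := div_unique (b := m) (q := Y' + a) (q' := n + 1 + t * m) hs h1
    (by linear_combination ht - ha)
  obtain ⟨a', -, s', hs', ha'⟩ := exists_div (pos_of_gt hn) a
  obtain ⟨-, rfl⟩ := div_unique (b := m) (q := a' + a) (q' := t) hs' hn'
    (by
      apply add_left_cancel (a := 1)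
      linear_combination h2 - ha - ha')
  exact ⟨Y', rfl, hY.of_dvd (dvd_mul_left _ _), hn', a', by rw [ha, ha']; ring⟩

lemma pow2_base (hm : Pow2 (m + 1)) : Pow2 (2 * m + 1 + 1) := by
  convert hm.double using 1; ring

/-- This is `(m + 1) ^ r ≤ (2 * m + 2) ^ r`, by induction on `r`, peeling off one factor on each
side. -/
lemma Cnt.le_double (hm : Pow2 (m + 1)) (hw : NoWrap m Z) (hw' : NoWrap (2 * m + 1) Z)
    (hV : V ≤ Z) (hW : W ≤ Z) (h : Cnt m r V) (h' : Cnt (2 * m + 1) r W) : V ≤ W := by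
  have hp : D0 fun r => ∀ V ≤ Z, ∀ W ≤ Z, Cnt m r V → Cnt (2 * m + 1) r W → V ≤ W :=
    .ballLE (.cst Z) (.ballLE (.cst Z) (.imp (.cnt (.cst m) (.var _) (.var _))
      (.imp (.cnt (.add (.mul (.ofNat 2) (.cst m)) .one) (.var _) (.var _))
        (.le (.var _) (.var _)))))
  refine hp.induction ?_ ?_ r V hV W hW h h'
  · intro V hV W hW h h'
    rw [h.eq_one hw hV, h'.eq_one hw' hW]
  · intro r ih V hV W hW h h'
    obtain ⟨V, rfl, h₁⟩ := h.pred hm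
    obtain ⟨W, rfl, h₂⟩ := h'.pred (pow2_base hm)
    have hVW := ih V ((le_mul_of_one_le_left zero_le le_add_self).trans hV)
      W ((le_mul_of_one_le_left zero_le le_add_self).trans hW) h₁ h₂
    have : m + 1 ≤ 2 * m + 1 + 1 := by
      rw [le_iff_exists_add]; exact ⟨m + 1, by ring⟩
    exact mul_le_mul this hVW zero_le zero_le

namespace SmallExp

lemma lt (h : SmallExp Z m r R) : r < m := by
  obtain ⟨-, V, -, W, -, h, -⟩ := h
  exact h.2.1

lemma eq_one (h : SmallExp Z m 0 R) (hw : NoWrap m Z) (hw' : NoWrap (2 * m + 1) Z) : R = 1 := by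
  obtain ⟨-, V, hV, W, hW, h, h', e⟩ := h
  rwa [h.eq_one hw hV, h'.eq_one hw' hW, one_mul, eq_comm] at e

lemma eq_zero (h : SmallExp Z m r 1) (hm : Pow2 (m + 1)) (hw : NoWrap m Z)
    (hw' : NoWrap (2 * m + 1) Z) : r = 0 := by
  obtain ⟨-, V, hV, W, hW, h, h', rfl⟩ := h
  rw [mul_one] at *
  by_contra hr
  obtain ⟨r, rfl⟩ := exists_eq_add_one hr
  obtain ⟨V₀, rfl, h₁⟩ := h.pred hm
  obtain ⟨W₀, e, h₂⟩ := h'.pred (pow2_base hm)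
  -- If `r` were positive, removing one factor from `V = W` would leave the smaller base with the
  -- larger power, against `Cnt.le_double`.
  have e' : V₀ = 2 * W₀ := by
    apply mul_left_cancel₀ hm.pos.ne'
    rw [e]; ring
  have hV' : V₀ ≤ Z := (le_mul_of_one_le_left zero_le le_add_self).trans hV
  have hW' : W₀ ≤ Z := (le_mul_of_one_le_left zero_le one_le_two).trans (e'.symm.trans_le hV')
  have := h₁.le_double hm hw hw' hV' hW' h₂
  rw [e'] at this
  exact this.not_gt (lt_mul_of_one_lt_left h₂.pow2.pos one_lt_two)

lemma pred (h : SmallExp Z m (r + 1) (2 * R)) (hm : Pow2 (m + 1)) : SmallExp Z m r R := by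
  obtain ⟨hR, V, hV, W, hW, h, h', e⟩ := h
  obtain ⟨V, rfl, h₁⟩ := h.pred hm
  obtain ⟨W, rfl, h₂⟩ := h'.pred (pow2_base hm)
  refine ⟨hR.of_dvd (dvd_mul_left _ _), V, (le_mul_of_one_le_left zero_le le_add_self).trans hV,
    W, (le_mul_of_one_le_left zero_le le_add_self).trans hW, h₁, h₂, ?_⟩
  apply mul_left_cancel₀ (two_ne_zero (α := M))
  apply mul_left_cancel₀ hm.pos.ne'
  linear_combination e

lemma half (h : SmallExp Z m r (2 * R)) (hm : Pow2 (m + 1)) (hw : NoWrap m Z)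
    (hw' : NoWrap (2 * m + 1) Z) : ∃ r', r = r' + 1 ∧ SmallExp Z m r' R := by
  rcases eq_or_ne r 0 with rfl | hr
  · have := h.eq_one hw hw'
    exact (two_mul_ne R 0 (by simpa using this)).elim
  · obtain ⟨r, rfl⟩ := exists_eq_add_one hr
    exact ⟨r, rfl, h.pred hm⟩

end SmallExp

/-- Provides room for another factor below `z`. The quotient `z / Y` is `1` modulo `k` and is not
`1`, so it is at least `k + 1`; equality is excluded since `n + 1` is not `0` modulo `k`. -/
lemma Cnt.climb (h : Cnt k n Y) (hk : Pow2 (k + 1)) (hn : n + 1 < k) (hz : Pow2 z) (hY : Y < z)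
    (hzw : ∃ t, z = 1 + t * (k * k)) : Cnt k (n + 1) ((k + 1) * Y) ∧ (k + 1) * Y < z := by
  have h' := h.succ hk hn
  refine ⟨h', lt_of_le_of_ne ?_ ?_⟩
  · obtain ⟨hY2, hnk, t, ht⟩ := h
    obtain ⟨s, hs⟩ := hzw
    obtain ⟨U, rfl⟩ := hY2.dvd hz hY.le
    obtain ⟨q, -, e, he, rfl⟩ := exists_div h'.pos U
    have h1 : 1 < k := lt_of_le_of_lt le_add_self hn
    obtain ⟨-, rfl⟩ := div_unique (b := k) (q := q + (n + t * k) * (k * q + e)) (q' := s * k) he h1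
      (by rw [mul_comm s, mul_comm t]; linear_combination hs - ht * (k * q + e))
    have hq : q ≠ 0 := by
      rintro rfl
      simp at hY
    rw [mul_comm Y]
    gcongr
    exact le_mul_of_one_le_right zero_le (one_le_iff.2 (pos_iff_ne_zero.2 hq))
  · obtain ⟨s, hs⟩ := hzw
    rw [hs]
    exact h'.not_wrap (by simp) s

/-- The half-size base `k + 1` has a power `z ≤ Z` whose exponent wraps, so its powers with counted
exponents below `k` can be built below `z`. Since `2 * (m + 1) = 4 * (k + 1) ≤ (k + 1) ^ 2`, the
witness `(2 * (m + 1)) ^ r` is dominated by `(k + 1) ^ (2 * r)`. -/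
lemma Suitable.exists_smallExp (h : Suitable m Z) (hR : Pow2 R) (hRm : R ≤ m + 1) :
    ∃ r, SmallExp Z m r R := by
  obtain ⟨hm, h31, hw, hw', k, -, rfl, hk⟩ := h
  have hk2 : Pow2 (k + 1) := hm.of_dvd ⟨2, by ring⟩
  have hk15 : 15 ≤ k := by
    by_contra! hc
    have h1 : (31 : DiffRing M) ≤ 2 * k + 1 := mod_cast h31
    have h2 : (k : DiffRing M) + 1 ≤ 15 := mod_cast add_one_le.2 hc
    linarith
  simp only [NoWrap] at hk
  push Not at hk
  obtain ⟨z, hzZ, hz, hzw, hz1⟩ := hk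
  -- Here `Y` plays the part of `(k + 1) ^ (2 * r)`. The last two inequalities say that `r` grows
  -- slowly compared with `R = 2 ^ r`; the first yields the second at the next stage, and the second
  -- gives `2 * r + 2 < k`, the room needed to climb twice.
  have key : ∀ R, Pow2 R → R ≤ 2 * k + 1 + 1 → ∃ r < k, ∃ Y ≤ Z, ∃ V ≤ Z, ∃ W ≤ Z,
      Cnt (2 * k + 1) r V ∧ Cnt (2 * (2 * k + 1) + 1) r W ∧ W = V * R ∧ W ≤ Y ∧ Y < z ∧
      Cnt k (2 * r) Y ∧ 2 * r ≤ R ∧ 4 * r ≤ R + 4 := by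
    intro R hR
    refine pow2_induction (p := fun R => R ≤ 2 * k + 1 + 1 → ∃ r < k, ∃ Y ≤ Z, ∃ V ≤ Z, ∃ W ≤ Z,
      Cnt (2 * k + 1) r V ∧ Cnt (2 * (2 * k + 1) + 1) r W ∧ W = V * R ∧ W ≤ Y ∧ Y < z ∧
      Cnt k (2 * r) Y ∧ 2 * r ≤ R ∧ 4 * r ≤ R + 4) ?_ ?_ ?_ hR
    · exact .imp (.le (.var _) (.cst (2 * k + 1 + 1))) (.bexLT (.cst k) (.bexLE (.cst Z)
        (.bexLE (.cst Z) (.bexLE (.cst Z) (.and (.cnt (.cst _) (.var _) (.var _))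
        (.and (.cnt (.cst _) (.var _) (.var _)) (.and (.eq (.var _) (.mul (.var _) (.var _)))
        (.and (.le (.var _) (.var _)) (.and (.lt (.var _) (.cst z))
        (.and (.cnt (.cst k) (.mul (.ofNat 2) (.var _)) (.var _))
        (.and (.le (.mul (.ofNat 2) (.var _)) (.var _))
        (.le (.mul (.ofNat 4) (.var _)) (.add (.var _) (.ofNat 4))))))))))))))
    · have h1z : 1 < z := lt_of_le_of_ne (one_le_iff.2 hz.pos) hz1.symm
      have h1Z : 1 ≤ Z := h1z.le.trans hzZ
      have hk0 : 0 < k := lt_of_lt_of_le (by norm_num) hk15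
      exact fun _ => ⟨0, hk0, 1, h1Z, 1, h1Z, 1, h1Z, cnt_one (lt_add_one.2 zero_le),
        cnt_one (lt_add_one.2 zero_le), by simp, le_rfl, h1z, by simpa using cnt_one hk0,
        by simp, by simp⟩
    · rintro R hR ih hRk
      have hRk' : 2 * (R : DiffRing M) ≤ 2 * k + 1 + 1 := mod_cast hRk
      have hR1 : 1 ≤ (R : DiffRing M) := mod_cast one_le_iff.2 hR.pos
      have hk' : 15 ≤ (k : DiffRing M) := mod_cast hk15
      obtain ⟨r, hr, Y, hY, V, hV, W, hW, hcV, hcW, e, hWY, hYz, hcY, hr2, hr4⟩ := ih (by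
        suffices (R : DiffRing M) ≤ 2 * k + 1 + 1 from mod_cast this
        linarith)
      have hr2' : 2 * (r : DiffRing M) ≤ R := mod_cast hr2
      have hr4' : 4 * (r : DiffRing M) ≤ R + 4 := mod_cast hr4
      have hrk : 2 * r + 1 + 1 < k := by
        suffices 2 * (r : DiffRing M) + 1 + 1 < k from mod_cast this
        linarith
      obtain ⟨h1, h1'⟩ := hcY.climb hk2 ((lt_add_one.2 le_rfl).trans hrk) hz hYz hzw
      obtain ⟨h2, h2'⟩ := h1.climb hk2 hrk hz h1' hzw
      have hWY' : (2 * (2 * k + 1) + 1 + 1) * W ≤ (k + 1) * ((k + 1) * Y) := by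
        rw [← mul_assoc]
        refine mul_le_mul ?_ hWY zero_le zero_le
        suffices 2 * (2 * (k : DiffRing M) + 1) + 1 + 1 ≤ (k + 1) * (k + 1) from mod_cast this
        nlinarith only [hk']
      have e' : (2 * (2 * k + 1) + 1 + 1) * W = (2 * k + 1 + 1) * V * (2 * R) := by
        rw [e]; ring
      have hVW : (2 * k + 1 + 1) * V ≤ (2 * (2 * k + 1) + 1 + 1) * W :=
        e' ▸ le_mul_of_one_le_right zero_le (one_le_iff.2 hR.double.pos)
      have hZ := h2'.le.trans hzZ
      have hrk₁ : 2 * (r : DiffRing M) + 1 + 1 < k := mod_cast hrk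
      have hr0 := DiffRing.coe_nonneg r
      have hrk' : r + 1 < k := by
        suffices (r : DiffRing M) + 1 < k from mod_cast this
        linarith
      refine ⟨r + 1, hrk', _, hZ, _, hVW.trans (hWY'.trans hZ), _, hWY'.trans hZ,
        hcV.succ hm ?_, hcW.succ (pow2_base hm) ?_, e', hWY', h2', ?_, ?_, ?_⟩
      · suffices (r : DiffRing M) + 1 < 2 * k + 1 from mod_cast this
        linarith only [hrk₁, hr0, hk']
      · suffices (r : DiffRing M) + 1 < 2 * (2 * k + 1) + 1 from mod_cast this
        linarith only [hrk₁, hr0, hk']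
      · convert h2 using 1; ring
      · rcases (one_le_iff.2 hR.pos).lt_or_eq with h | rfl
        · have h := add_one_le.2 h
          have : (1 : DiffRing M) + 1 ≤ R := mod_cast h
          suffices 2 * ((r : DiffRing M) + 1) ≤ 2 * R from mod_cast this
          linarith
        · have : r = 0 := by
            by_contra h
            have : (1 : DiffRing M) ≤ r := mod_cast one_le_iff.2 (pos_iff_ne_zero.2 h)
            have : (2 : DiffRing M) * r ≤ 1 := mod_cast hr2
            linarith
          simp [this]
      · suffices 4 * ((r : DiffRing M) + 1) ≤ 2 * R + 4 from mod_cast this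
        linarith
  obtain ⟨r, -, -, -, V, hV, W, hW, h1, h2, e, -⟩ := key R hR hRm
  exact ⟨r, hR, V, hV, W, hW, h1, h2, e⟩

/-- A nonzero multiple of `m * m` already exceeds `Z`. -/
lemma noWrap_of_lt (h : Z < m) : NoWrap m Z := by
  rintro Y hY hY2 ⟨t, rfl⟩
  rcases eq_or_ne t 0 with rfl | ht
  · simp
  · have h1 : 1 ≤ t := one_le_iff.2 (pos_iff_ne_zero.2 ht)
    have h2 : 1 ≤ m := one_le_iff.2 (pos_of_gt h)
    have h3 : m ≤ t * (m * m) :=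
      (le_mul_of_one_le_left zero_le h2).trans (le_mul_of_one_le_left zero_le h1)
    exact ((h3.trans (le_add_self.trans hY)).not_gt h).elim

lemma Suitable.le (h : Suitable m Z) : m ≤ 2 * Z + 1 := by
  obtain ⟨-, -, -, -, k, -, rfl, hk⟩ := h
  have : k ≤ Z := not_lt.1 fun hc => hk (noWrap_of_lt hc)
  gcongr

/-- The least `m ≥ 31` without wrapping for `m + 1` and `2 * (m + 1)` is taken. By minimality the
base of half the size wraps, unless it falls below the threshold, which leaves only the base `16`.
-/
lemma exists_suitable (hZ : 2 ^ 60 ≤ Z) : ∃ m, Suitable m Z := by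
  have hp : D0 fun m : M => 31 ≤ m ∧ Pow2 (m + 1) ∧ NoWrap m Z ∧ NoWrap (2 * m + 1) Z :=
    .and (.le (.ofNat 31) (.var _)) (.and (.pow2 (.add (.var _) .one)) (.and
      (.noWrap (.var _) (.cst Z)) (.noWrap (.add (.mul (.ofNat 2) (.var _)) .one) (.cst Z))))
  -- Adding `32` makes the candidate both at least `31` and larger than `Z`.
  obtain ⟨u, hu, hZu⟩ := exists_pow2 (Z + 32)
  obtain ⟨m₀, rfl⟩ := exists_eq_add_one hu.pos.ne'
  have hm₀ : Z + 32 ≤ m₀ := lt_add_one.1 hZu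
  have hZm₀ : Z < m₀ := lt_of_lt_of_le (lt_add_of_pos_right _ (by norm_num)) hm₀
  obtain ⟨m, ⟨h31, hm, hw, hw'⟩, hmin⟩ := hp.least (x := m₀)
    ⟨le_trans (by norm_num) (le_add_self.trans hm₀), hu, noWrap_of_lt hZm₀,
      noWrap_of_lt (hZm₀.trans_le ((le_mul_of_one_le_left zero_le one_le_two).trans le_self_add))⟩
  refine ⟨m, hm, h31, hw, hw', ?_⟩
  have h31' : 31 ≤ (m : DiffRing M) := mod_cast h31
  rcases hm.cases with h | ⟨k, hk, hk2⟩
  · have : (m : DiffRing M) + 1 = 1 := mod_cast h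
    linarith only [h31', this]
  obtain ⟨k, rfl⟩ := exists_eq_add_one hk2.pos.ne'
  obtain rfl : m = 2 * k + 1 := by
    apply add_right_cancel (b := 1)
    rw [hk]; ring
  have h31'' : 31 ≤ 2 * (k : DiffRing M) + 1 := mod_cast h31
  have hkm : k < 2 * k + 1 := lt_add_one.2 (le_mul_of_one_le_left zero_le one_le_two)
  refine ⟨k, hkm.le, rfl, fun hkw => ?_⟩
  rcases le_or_gt 31 k with h | h
  · exact hmin k hkm ⟨h, hk2, hkw, hw⟩
  · have h1 : (k : DiffRing M) + 1 ≤ 31 := mod_cast add_one_le.2 h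
    have h16 : Pow2 (16 : M) := by convert pow2_two_pow (M := M) 4 using 1; norm_num
    obtain rfl : k = 15 := by
      apply add_right_cancel (b := 1)
      refine le_antisymm ?_ ?_
      · by_contra! hc
        have h2 := h16.two_mul_le hk2 (by convert hc using 1; norm_num)
        have h3 : (2 : DiffRing M) * 16 ≤ k + 1 := mod_cast h2
        linarith only [h1, h3]
      · suffices (15 : DiffRing M) + 1 ≤ k + 1 from mod_cast this
        linarith only [h31'']
    -- Here `2 ^ 60 = 16 ^ 15` has exponent `15`, so it wraps for `k = 15`: it equals `1 +
    -- 5124095576030431 * 15 ^ 2`. This is the source of the constant `60`.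
    have := hkw (2 ^ 60) hZ (pow2_two_pow 60) ⟨5124095576030431, by norm_num⟩
    norm_num at this

namespace BaseExp

/-- Bounds the exponents quantified over in the induction for `BaseExp.unique`. -/
lemma le (h : BaseExp Z m x y) : x ≤ m * m + m := by
  obtain ⟨Y, hY, R, hR, n, hn, d, hd, r, hr, -, -, -, -, rfl⟩ := h
  gcongr

lemma eq_zero (h : BaseExp Z m x 1) (hs : Suitable m Z) : x = 0 := by
  obtain ⟨Y, hY, R, hR, n, hn, d, hd, r, hr, e, h1, h2, h3, rfl⟩ := h
  obtain ⟨hm, h31, hw, hw', -⟩ := hs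
  have hR1 : R = 1 := le_antisymm (e ▸ le_mul_of_one_le_left zero_le (one_le_iff.2 h1.pow2.pos))
    (one_le_iff.2 h3.1.pos)
  subst hR1
  rw [mul_one] at e
  subst e
  rw [h1.eq_zero, h3.eq_zero hm hw hw', mul_zero, add_zero]

lemma half (h : BaseExp Z m x (2 * y)) (hs : Suitable m Z) (hyZ : 2 * y ≤ Z) :
    ∃ x', x = x' + 1 ∧ BaseExp Z m x' y := by
  obtain ⟨Y, hY, R, hR, n, hn, d, hd, r, hr, e, h1, h2, h3, rfl⟩ := h
  obtain ⟨hm, h31, hw, hw', k, -, hk, -⟩ := hs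
  -- If `R = 1`, a factor is borrowed from `Y`: one power of `m + 1 = 2 * (k + 1)` is removed and
  -- `R` becomes `k + 1 = 2 ^ (d - 1)`. Otherwise `R` itself is halved.
  rcases h3.1.cases with rfl | ⟨R, rfl, hR2⟩
  · have hr0 := h3.eq_zero hm hw hw'
    subst hr0
    rw [mul_one] at e
    have hn0 : n ≠ 0 := by
      rintro rfl
      have := h1.eq_one hw (e ▸ hyZ)
      rw [← e] at this
      exact two_mul_ne y 0 (by simpa using this)
    obtain ⟨n, rfl⟩ := exists_eq_add_one hn0
    obtain ⟨Y, rfl, h1'⟩ := h1.pred hm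
    have hmk : m + 1 = 2 * (k + 1) := by rw [hk]; ring
    have h2' := h2
    rw [hmk] at h2'
    obtain ⟨r, rfl, h3'⟩ := h2'.half hm hw hw'
    have e' : y = Y * (k + 1) := by
      apply mul_left_cancel₀ (two_ne_zero (α := M))
      rw [e, hmk]; ring
    refine ⟨(r + 1) * n + r, by ring, Y, ?_, k + 1, ?_, n, (lt_add_one.2 le_rfl).trans hn, r + 1,
      hd, r, (lt_add_one.2 le_rfl).trans hd, e', h1', h2, h3', rfl⟩
    · rw [e']; exact le_mul_of_one_le_right zero_le le_add_self
    · rw [hk]; gcongr; exact le_mul_of_one_le_left zero_le one_le_two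
  · obtain ⟨r, rfl, h3'⟩ := h3.half hm hw hw'
    have e' : y = Y * R := by
      apply mul_left_cancel₀ (two_ne_zero (α := M))
      rw [e]; ring
    refine ⟨d * n + r, by ring, Y, ?_, R, ?_, n, hn, d, hd, r, (lt_add_one.2 le_rfl).trans hr, e',
      h1, h2, h3', rfl⟩
    · rw [e']; exact le_mul_of_one_le_right zero_le (one_le_iff.2 hR2.pos)
    · exact (le_mul_of_one_le_left zero_le one_le_two).trans hR

end BaseExp

lemma Suitable.exists_baseExp (hs : Suitable m Z) (hy : Pow2 y) (hyZ : y ≤ Z) :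
    ∃ x, BaseExp Z m x y := by
  have hm := hs.1
  have hm0 : 0 < m := lt_of_lt_of_le (by norm_num) hs.2.1
  have hw := hs.2.2.1
  have key : y ≤ Z → ∃ Y ≤ y, ∃ R ≤ m, ∃ n < m, y = Y * R ∧ Pow2 R ∧ Cnt m n Y := by
    refine pow2_induction (p := fun y => y ≤ Z → ∃ Y ≤ y, ∃ R ≤ m, ∃ n < m, y = Y * R ∧ Pow2 R ∧
      Cnt m n Y) ?_ ?_ ?_ hy
    · exact .imp (.le (.var _) (.cst Z)) (.bexLE (.var _) (.bexLE (.cst m) (.bexLT (.cst m) (.and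
        (.eq (.var _) (.mul (.var _) (.var _))) (.and (.pow2 (.var _))
        (.cnt (.cst m) (.var _) (.var _)))))))
    · exact fun _ => ⟨1, le_rfl, 1, one_le_iff.2 hm0, 0, hm0, by simp, pow2_one, cnt_one hm0⟩
    · intro y hy ih hyZ
      obtain ⟨Y, hY, R, hR, n, hn, rfl, hR2, h⟩ :=
        ih ((le_mul_of_one_le_left zero_le one_le_two).trans hyZ)
      have h2R : 2 * R ≤ m + 1 := hR2.two_mul_le hm (lt_add_one.2 hR)
      -- Either the doubled `R` remains below the base, or it reaches it and is carried into `Y`.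
      rcases h2R.lt_or_eq with hlt | heq
      · exact ⟨Y, hY.trans (le_mul_of_one_le_left zero_le one_le_two), 2 * R, lt_add_one.1 hlt, n,
          hn, by ring, hR2.double, h⟩
      · have e : 2 * (Y * R) = (m + 1) * Y := by rw [← heq]; ring
        have h' := h.succ_of_noWrap hm hw (e ▸ hyZ)
        exact ⟨_, e.ge, 1, one_le_iff.2 hm0, n + 1, h'.2.1, by rw [e, mul_one], pow2_one, h'⟩
  obtain ⟨Y, hY, R, hR, n, hn, e, hR2, h⟩ := key hyZ
  obtain ⟨d, hd⟩ := hs.exists_smallExp hm le_rfl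
  obtain ⟨r, hr⟩ := hs.exists_smallExp hR2 (hR.trans le_self_add)
  exact ⟨_, Y, hY, R, hR, n, hn, d, hd.lt, r, hr.lt, e, h, hd, hr, rfl⟩

/-- Halving `y` lowers the exponent by one in any base, so by induction the bases and bounds are
irrelevant. This is needed because the bound used in `Exp` varies with `y`. -/
lemma BaseExp.unique {m' x' Z' : M} (hs : Suitable m Z) (hs' : Suitable m' Z') (hy : Pow2 y)
    (hyZ : y ≤ Z) (hyZ' : y ≤ Z') (h : BaseExp Z m x y) (h' : BaseExp Z' m' x' y) : x = x' := by
  refine pow2_induction (p := fun y => y ≤ Z → y ≤ Z' → ∀ x ≤ m * m + m, ∀ x' ≤ m' * m' + m',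
    BaseExp Z m x y → BaseExp Z' m' x' y → x = x') ?_ ?_ ?_ hy hyZ hyZ' x h.le x' h'.le h h'
  · exact .imp (.le (.var _) (.cst Z)) (.imp (.le (.var _) (.cst Z')) (.ballLE (.cst _)
      (.ballLE (.cst _) (.imp (.baseExp (.cst Z) (.cst m) (.var _) (.var _))
      (.imp (.baseExp (.cst Z') (.cst m') (.var _) (.var _)) (.eq (.var _) (.var _)))))))
  · intro _ _ x _ x' _ h h'
    rw [h.eq_zero hs, h'.eq_zero hs']
  · intro y hy ih hyZ hyZ' x _ x' _ h h'
    obtain ⟨x, rfl, h₁⟩ := h.half hs hyZ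
    obtain ⟨x', rfl, h₁'⟩ := h'.half hs' hyZ'
    have hle : y ≤ 2 * y := le_mul_of_one_le_left zero_le one_le_two
    rw [ih (hle.trans hyZ) (hle.trans hyZ') x h₁.le x' h₁'.le h₁ h₁']

lemma le_expBound (y : M) : y ≤ 2 ^ 60 * y := le_mul_of_one_le_left zero_le (by norm_num)

lemma exists_exp (hy : Pow2 y) : ∃ m x, Suitable m (2 ^ 60 * y) ∧ BaseExp (2 ^ 60 * y) m x y ∧
    Exp x y := by
  obtain ⟨m, hm⟩ := exists_suitable (Z := 2 ^ 60 * y)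
    (le_mul_of_one_le_right zero_le (one_le_iff.2 hy.pos))
  obtain ⟨x, hx⟩ := hm.exists_baseExp hy (le_expBound y)
  exact ⟨m, x, hm, hx, hy, m, hm.le, hm, hx⟩

lemma Exp.zero_one : Exp (0 : M) 1 := by
  obtain ⟨m, x, hm, h, h'⟩ := exists_exp (pow2_one (M := M))
  rwa [h.eq_zero hm] at h'

lemma Exp.eq_one (h : Exp 0 y) : y = 1 := by
  obtain ⟨hy, m, -, hm, h⟩ := h
  rcases hy.cases with rfl | ⟨y, rfl, -⟩
  · rfl
  · obtain ⟨x, hx, -⟩ := h.half hm (le_expBound _)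
    exact ((lt_add_one.2 zero_le).ne hx).elim

lemma Exp.double (h : Exp x y) : Exp (x + 1) (2 * y) := by
  obtain ⟨hy, m, -, hm, h⟩ := h
  -- The base belonging to `2 * y` may differ from that of `y`, so the new representation is halved
  -- in its own base and then compared.
  obtain ⟨m', x', hm', h', h''⟩ := exists_exp hy.double
  obtain ⟨x', rfl, h₁⟩ := h'.half hm' (le_expBound _)
  have hle : y ≤ 2 ^ 60 * (2 * y) :=
    (le_mul_of_one_le_left zero_le one_le_two).trans (le_expBound _)
  rwa [BaseExp.unique hm hm' hy (le_expBound _) hle h h₁]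

lemma Exp.half (h : Exp (x + 1) z) : ∃ y, z = 2 * y ∧ Exp x y := by
  obtain ⟨hz, m, -, hm, h⟩ := h
  rcases hz.cases with rfl | ⟨y, rfl, hy⟩
  · have := h.eq_zero hm
    simp at this
  · obtain ⟨m', x', hm', h', h''⟩ := exists_exp hy
    obtain ⟨x₁, hx, h₁⟩ := h.half hm (le_expBound _)
    have hle : y ≤ 2 ^ 60 * (2 * y) :=
      (le_mul_of_one_le_left zero_le one_le_two).trans (le_expBound _)
    rw [BaseExp.unique hm' hm hy (le_expBound _) hle h' h₁, ← add_right_cancel hx] at h''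
    exact ⟨y, rfl, h''⟩

/-- Induction on the exponent, halving both values; the bounds `y` and `z` keep the statement `Δ₀`.
-/
lemma Exp.unique (h : Exp x y) (h' : Exp x z) : y = z := by
  have hp : D0 fun x => ∀ w ≤ y, ∀ w' ≤ z, Exp x w → Exp x w' → w = w' :=
    .ballLE (.cst y) (.ballLE (.cst z) (.imp (.exp (.var _) (.var _))
      (.imp (.exp (.var _) (.var _)) (.eq (.var _) (.var _)))))
  refine hp.induction ?_ ?_ x y le_rfl z le_rfl h h'
  · intro w _ w' _ h h'
    rw [h.eq_one, h'.eq_one]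
  · intro x ih w hw w' hw' h h'
    obtain ⟨w, rfl, h₁⟩ := h.half
    obtain ⟨w', rfl, h₁'⟩ := h'.half
    have hle : ∀ y : M, y ≤ 2 * y := fun y => le_mul_of_one_le_left zero_le one_le_two
    rw [ih w ((hle _).trans hw) w' ((hle _).trans hw') h₁ h₁']

lemma Exp.initial (h : Exp x y) (hz : z < x) : ∃ w, Exp z w := by
  have hp : D0 fun x => ∀ v ≤ y, Exp x v → ∀ z < x, ∃ w ≤ y, Exp z w :=
    .ballLE (.cst y) (.imp (.exp (.var _) (.var _)) (.ballLT (.var _) (.bexLE (.cst y)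
      (.exp (.var _) (.var _)))))
  obtain ⟨w, -, hw⟩ := hp.induction (fun _ _ _ z hz => (not_lt_zero hz).elim) (by
    intro x ih v hv h z hz
    obtain ⟨w, rfl, hw⟩ := h.half
    have hwy : w ≤ y := (le_mul_of_one_le_left zero_le one_le_two).trans hv
    rcases (lt_add_one.1 hz).lt_or_eq with hz | rfl
    · exact ih w hwy hw z hz
    · exact ⟨w, hwy, hw⟩) x y le_rfl h z hz
  exact ⟨w, hw⟩

end Mod

/-! ### The axioms on exponentiation and the existence of an exponentiation formula. -/

section ExpSentences

variable {N : Type u} [LA.Structure N] {E : LA.Formula (Fin 2)}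

lemma realize_exp_zero : N ⊨ (app E 0 1 : LA.Sentence) ↔ E.Realize ![fzero N, fsucc (fzero N)] := by
  rw [Sentence.Realize, Formula.Realize, realize_app, realize_zero, realize_one]

lemma realize_exp_unique :
    N ⊨ (∀' ∀' ∀' (app E &0 &1 ⊓ app E &0 &2 ⟹ (&1 =' &2)) : LA.Sentence) ↔
      ∀ x y z : N, E.Realize ![x, y] → E.Realize ![x, z] → y = z := by
  rw [Sentence.Realize, Formula.Realize]
  simp only [BoundedFormula.realize_all, BoundedFormula.realize_imp, BoundedFormula.realize_inf,
    realize_app, BoundedFormula.realize_bdEqual, and_imp]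
  rfl

lemma realize_exp_initial :
    N ⊨ (∀' ((∃' app E &0 &1) ⟹ ballLT &0 (∃' app E &1 &2)) : LA.Sentence) ↔
      ∀ x : N, (∃ y, E.Realize ![x, y]) → ∀ z, Lt z x → ∃ y, E.Realize ![z, y] := by
  rw [Sentence.Realize, Formula.Realize]
  simp only [BoundedFormula.realize_all, BoundedFormula.realize_imp, BoundedFormula.realize_ex,
    realize_app, realize_ballLT]
  rfl

lemma realize_exp_succ :
    N ⊨ (∀' ∀' (app E &0 &1 ⟹ app E (&0 + 1) ((1 + 1) * &1)) : LA.Sentence) ↔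
      ∀ x y : N, E.Realize ![x, y] → E.Realize ![fadd x (fsucc (fzero N)),
        fmul (fadd (fsucc (fzero N)) (fsucc (fzero N))) y] := by
  rw [Sentence.Realize, Formula.Realize]
  simp only [BoundedFormula.realize_all, BoundedFormula.realize_imp, realize_app, realize_add,
    realize_mul, realize_one]
  rfl

lemma realize_totality : N ⊨ totality E ↔ ∀ x : N, ∃ y, E.Realize ![x, y] := by
  rw [totality, Sentence.Realize, Formula.Realize]
  simp only [BoundedFormula.realize_all, BoundedFormula.realize_ex, realize_app]
  rfl

end ExpSentences

theorem exists_isExpGraph : ∃ E : LA.Formula (Fin 2), IsExpGraph E := by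
  -- The family is indexed by all models and has no parameters, so one formula defines `Exp` in
  -- every model at once.
  obtain ⟨φ, hφ, h⟩ : Def (I := Mod.{0}) (𝓜 := fun M => M) (Γ := Empty) (fun _ => Empty.elim)
      (α := Fin 2) fun _ v => Mod.Exp (v 0) (v 1) := .exp (.var 0) (.var 1)
  let E : LA.Formula (Fin 2) := BoundedFormula.subst φ (Sum.elim Empty.elim Term.var)
  have hE : ∀ (M : Mod.{0}) (v : Fin 2 → M), E.Realize v ↔ Mod.Exp (v 0) (v 1) := by
    intro M v
    refine Iff.trans ?_ (h M v)
    rw [Formula.Realize, BoundedFormula.realize_subst]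
    refine iff_of_eq (congrArg₂ _ (funext fun a => ?_) rfl)
    rcases a with a | a
    · exact a.elim
    · rfl
  have key : ∀ σ : LA.Sentence, (∀ M : Mod.{0}, M ⊨ σ) → IDelta0 ⊨ᵇ σ := fun σ hσ =>
    Theory.models_sentence_iff.2 fun N => hσ ⟨N, N.is_model⟩
  refine ⟨E, hφ.subst _, key _ fun M => ?_, key _ fun M => ?_, key _ fun M => ?_,
    key _ fun M => ?_⟩
  · exact realize_exp_zero.2 ((hE M _).2 Mod.Exp.zero_one)
  · rw [realize_exp_unique]
    simp only [hE]
    exact fun x y z h h' => Mod.Exp.unique h h'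
  · rw [realize_exp_initial]
    simp only [hE]
    exact fun x ⟨y, h⟩ z hz => Mod.Exp.initial h hz
  · rw [realize_exp_succ]
    simp only [hE]
    intro x y h
    have : Mod.Exp (x + 1) (2 * y) := Mod.Exp.double h
    rw [← one_add_one_eq_two] at this
    exact this

/-! ### Embeddings preserve the operations and the order. -/

section Embedding

variable {A B : Type*} [LA.Structure A] [LA.Structure B] (f : A ↪[LA] B)

lemma map_fzero : f (fzero A) = fzero B :=
  (f.map_fun (Func.zero : LA.Functions 0) _).trans (congrArg _ (Subsingleton.elim _ _))

lemma map_fsucc (a : A) : f (fsucc a) = fsucc (f a) :=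
  (f.map_fun (Func.succ : LA.Functions 1) _).trans
    (congrArg _ (funext fun i => by fin_cases i; rfl))

lemma map_fadd (a b : A) : f (fadd a b) = fadd (f a) (f b) :=
  (f.map_fun (Func.add : LA.Functions 2) _).trans
    (congrArg _ (funext fun i => by fin_cases i <;> rfl))

lemma map_fmul (a b : A) : f (fmul a b) = fmul (f a) (f b) :=
  (f.map_fun (Func.mul : LA.Functions 2) _).trans
    (congrArg _ (funext fun i => by fin_cases i <;> rfl))

lemma map_Lt (a b : A) : Lt (f a) (f b) ↔ Lt a b := by
  rw [Lt, Lt, ← f.map_rel (Rel.lt : LA.Relations 2) ![a, b] ]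
  exact iff_of_eq (congrArg _ (funext fun i => by fin_cases i <;> rfl))

end Embedding

/-! ### Initial segments as models of `IΔ₀` and `BΣ₁`. -/

section InitialSegment

/-- A substructure that is an initial segment. -/
def IsInitial {A : Type*} [LA.Structure A] (N : LA.Substructure A) : Prop :=
  ∀ a ∈ N, ∀ b, Lt b a → b ∈ N

/-- The bound of a quantifier takes its value in `N`, so every element below it lies in `N` too. -/
lemma IsDelta0.realize_initial {A : Type*} [LA.Structure A] {N : LA.Substructure A}
    (hN : IsInitial N) {β : Type*} {n : ℕ} {φ : LA.BoundedFormula β n} (h : IsDelta0 φ)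
    (v : β → N) (xs : Fin n → N) :
    φ.Realize v xs ↔ φ.Realize (fun b => (v b : A)) (fun i => (xs i : A)) := by
  have ht : ∀ {n : ℕ} (t : LA.Term (β ⊕ Fin n)) (xs : Fin n → N),
      t.realize (Sum.elim (fun b => (v b : A)) (fun i => (xs i : A))) =
        (t.realize (Sum.elim v xs) : N) := by
    intro n t xs
    rw [← N.subtype_apply, ← HomClass.realize_term N.subtype]
    congr 1
    ext i
    cases i <;> rfl
  have hs : ∀ {n : ℕ} (xs : Fin n → N) (a : N), (fun i => ((Fin.snoc xs a : Fin (n + 1) → N) i : A))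
      = Fin.snoc (fun i => (xs i : A)) (a : A) := by
    intro n xs a
    exact Fin.comp_snoc (fun x : N => (x : A)) xs a
  induction h with
  | falsum => exact Iff.rfl
  | equal t s =>
    rw [BoundedFormula.realize_bdEqual, BoundedFormula.realize_bdEqual, ht, ht]
    exact Subtype.ext_iff
  | rel R ts =>
    simp only [BoundedFormula.Realize, ht]
    exact (N.subtype.map_rel R _).symm
  | imp _ _ ih₁ ih₂ => exact imp_congr (ih₁ xs) (ih₂ xs)
  | ball t _ ih =>
    rw [realize_ballLT, realize_ballLT, ht]
    constructor
    · intro h a ha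
      have haN := hN _ (t.realize (Sum.elim v xs)).2 a ha
      have := (ih _).1 (h ⟨a, haN⟩ ((map_Lt N.subtype _ _).1 ha))
      rwa [hs] at this
    · intro h a ha
      refine (ih _).2 ?_
      rw [hs]
      exact h a ((map_Lt N.subtype _ _).2 ha)
  | bex t _ ih =>
    rw [realize_bexLT, realize_bexLT, ht]
    constructor
    · rintro ⟨a, ha, h⟩
      have := (ih _).1 h
      rw [hs] at this
      exact ⟨a, (map_Lt N.subtype _ _).2 ha, this⟩
    · rintro ⟨a, ha, h⟩
      have haN := hN _ (t.realize (Sum.elim v xs)).2 a ha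
      refine ⟨⟨a, haN⟩, (map_Lt N.subtype _ _).1 ha, (ih _).2 ?_⟩
      rw [hs]
      exact h

variable {M : Mod.{u}} {N : LA.Substructure M}

namespace IsInitial

lemma mem_of_le (hN : IsInitial N) {a b : M} (ha : a ∈ N) (h : b ≤ a) : b ∈ N := by
  rcases h.lt_or_eq with h | rfl
  · exact hN a ha b h
  · exact ha

lemma facts (hN : IsInitial N) : PAFacts N := by
  have h0 : ((fzero N : N) : M) = fzero M := map_fzero N.subtype
  have h1 : ∀ a : N, ((fsucc a : N) : M) = fsucc (a : M) := map_fsucc N.subtype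
  have h2 : ∀ a b : N, ((fadd a b : N) : M) = fadd (a : M) b := map_fadd N.subtype
  have h3 : ∀ a b : N, ((fmul a b : N) : M) = fmul (a : M) b := map_fmul N.subtype
  have h4 : ∀ a b : N, Lt a b ↔ Lt (a : M) b := fun a b => (map_Lt N.subtype a b).symm
  have F := M.facts
  constructor
  -- The only axiom asserting existence; the difference lies below `b`, hence in `N`. The others are
  -- universal and pass to `N`.
  case exists_add =>
    intro a b h
    obtain ⟨c, hc⟩ := F.exists_add _ _ ((h4 a b).1 h)
    have : c ≤ (b : M) := hc ▸ (le_add_self : c ≤ (a : M) + c)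
    exact ⟨⟨c, hN.mem_of_le b.2 this⟩, Subtype.ext ((h2 _ _).trans hc)⟩
  all_goals simp only [Subtype.ext_iff, h0, h1, h2, h3, h4, Subtype.forall]
  · exact fun a _ b _ c _ => F.add_assoc a b c
  · exact fun a _ b _ => F.add_comm a b
  · exact fun a _ b _ c _ => F.mul_assoc a b c
  · exact fun a _ b _ => F.mul_comm a b
  · exact fun a _ b _ c _ => F.mul_add a b c
  · exact fun a _ => F.add_zero a
  · exact fun a _ => F.mul_zero a
  · exact fun a _ => F.mul_one a
  · exact fun a _ => F.succ_eq a
  · exact fun a _ b _ c _ => F.lt_trans a b c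
  · exact fun a _ => F.lt_irrefl a
  · exact fun a _ b _ => F.lt_total a b
  · exact fun a _ b _ c _ => F.add_lt_add a b c
  · exact fun a _ b _ c _ => F.mul_lt_mul a b c
  · exact F.zero_lt_one
  · exact fun a _ => F.discrete a
  · exact fun a _ => F.nonneg a

theorem models_IDelta0 (hN : IsInitial N) : N ⊨ IDelta0 := by
  refine models_IDelta0_iff.2 ⟨hN.facts, fun k φ hφ p h0 hs c => ?_⟩
  have key : ∀ x : N, φ.Realize (Sum.elim p fun _ => x) ↔
      φ.Realize (Sum.elim (fun i => (p i : M)) fun _ => (x : M)) := by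
    intro x
    refine (hφ.realize_initial hN _ _).trans (iff_of_eq (congrArg₂ _ (funext fun i => ?_)
      (Subsingleton.elim _ _)))
    cases i <;> rfl
  -- Induction is carried out in `M`, cut off at `c`, because the induction step is known only
  -- inside `N`.
  have hp : Mod.D0 fun x : M => x ≤ c → φ.Realize (Sum.elim (fun i => (p i : M)) fun _ => x) := by
    refine .imp (.le (.var _) (.cst (c : M))) ?_
    refine (Def.of_formula hφ (F := Sum.elim (fun i _ _ => (p i : M)) fun _ _ v => v ()) ?_).of_iff
      fun i v => iff_of_eq (congrArg _ (funext fun b => ?_))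
    · rintro (i | i)
      · exact .cst _
      · exact .var _
    · cases b <;> rfl
  refine (key c).2 (hp.induction (fun _ => ?_) (fun x ih hx => ?_) c le_rfl)
  · rw [key] at h0
    rwa [show ((fzero N : N) : M) = 0 from map_fzero N.subtype] at h0
  · have hxc : x ≤ c := (Mod.add_one_le.1 hx).le
    have := hs ⟨x, hN.mem_of_le c.2 hxc⟩ ((key _).2 (ih hxc))
    rw [key] at this
    rwa [show ((fsucc (⟨x, hN.mem_of_le c.2 hxc⟩ : N) : N) : M) = x + 1 from
      (map_fsucc N.subtype _).trans (M.fsucc_eq x)] at this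

end IsInitial

lemma realize_collectionAxiom {A : Type*} [LA.Structure A] {k : ℕ}
    (φ : LA.Formula (Fin k ⊕ Fin 2)) : A ⊨ collectionAxiom φ ↔ ∀ (p : Fin k → A) (v : A),
      (∀ x, Lt x v → ∃ y, φ.Realize (Sum.elim p ![x, y])) →
        ∃ z, ∀ x, Lt x v → ∃ y, Lt y z ∧ φ.Realize (Sum.elim p ![x, y]) := by
  rw [collectionAxiom, realize_close]
  refine forall_congr' fun p => ?_
  rw [Formula.Realize]
  simp only [BoundedFormula.realize_all, BoundedFormula.realize_imp, BoundedFormula.realize_ex,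
    realize_ballLT, realize_bexLT, realize_ren]
  have e₁ : ∀ v x y : A, Sum.elim p
      (Fin.snoc (Fin.snoc (Fin.snoc default v : Fin 1 → A) x : Fin 2 → A) y : Fin 3 → A) ∘
      Sum.map id ![1, 2] = Sum.elim p ![x, y] := by
    intro v x y
    ext i
    rcases i with i | i
    · rfl
    · fin_cases i <;> rfl
  have e₂ : ∀ v z x y : A, Sum.elim p
      (Fin.snoc (Fin.snoc (Fin.snoc (Fin.snoc default v : Fin 1 → A) z : Fin 2 → A)
      x : Fin 3 → A) y : Fin 4 → A) ∘ Sum.map id ![2, 3] = Sum.elim p ![x, y] := by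
    intro v z x y
    ext i
    rcases i with i | i
    · rfl
    · fin_cases i <;> rfl
  simp only [e₁, e₂]
  rfl

/-- A `Σ₁`-formula is true in a proper initial segment `N` if and only if the formula obtained from
it by bounding all the initial existential quantifiers by some `b` is true; here any `b` above `N`
is large enough, and if `b` is in `N`, then so are the witnesses. -/
lemma IsSigma1.exists_bounded {β : Type*} {n : ℕ} {φ : LA.BoundedFormula β n} (h : IsSigma1 φ) :
    ∃ ψ : LA.BoundedFormula (Option β) n, IsDelta0 ψ ∧
      ∀ (M : Mod.{u}) (N : LA.Substructure M), IsInitial N → ∀ (v : β → N) (xs : Fin n → N) (b : M),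
        (b ∉ N → φ.Realize v xs →
          ψ.Realize (fun o => o.elim b fun i => (v i : M)) (fun i => (xs i : M))) ∧
        (b ∈ N → ψ.Realize (fun o => o.elim b fun i => (v i : M)) (fun i => (xs i : M)) →
          φ.Realize v xs) := by
  induction h with
  | delta0 h =>
    refine ⟨_, h.subst fun b => Term.var (some b), fun M N hN v xs b => ?_⟩
    rw [BoundedFormula.realize_subst, h.realize_initial hN]
    exact ⟨fun _ => id, fun _ => id⟩
  | @ex n φ _ ih =>
    obtain ⟨ψ, hψ, h⟩ := ih
    refine ⟨bexLT (Term.var (Sum.inl none)) ψ, .bex _ hψ, fun M N hN v xs b => ?_⟩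
    have hs : ∀ (a : N), (fun i => ((Fin.snoc xs a : Fin (n + 1) → N) i : M))
      = Fin.snoc (fun i => (xs i : M)) (a : M) := by
      intro a
      exact Fin.comp_snoc (fun x : N => (x : M)) xs a
    rw [BoundedFormula.realize_ex, realize_bexLT]
    constructor
    · rintro hb ⟨a, ha⟩
      refine ⟨a, ?_, ?_⟩
      · exact not_le.1 fun hc => hb (hN.mem_of_le a.2 hc)
      · have := (h M N hN v (Fin.snoc xs a) b).1 hb ha
        rwa [hs] at this
    · rintro hb ⟨a, hab, ha⟩
      have haN : a ∈ N := hN b hb a hab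
      refine ⟨⟨a, haN⟩, (h M N hN v _ b).2 hb ?_⟩
      rw [hs]
      exact ha

/-- Underspill: every `b` outside `N` bounds all the witnesses, by a `Δ₀` condition on `b`. The
least bound must therefore lie in `N`, and it brings the witnesses into `N` as well. -/
theorem IsInitial.models_BSigma1 (hN : IsInitial N) {c : M} (hc : c ∉ N) : N ⊨ BSigma1 := by
  rw [Theory.model_iff]
  rintro _ ⟨k, φ, hφ, rfl⟩
  rw [realize_collectionAxiom]
  intro p v h
  obtain ⟨ψ, hψ, hb⟩ := hφ.exists_bounded
  replace hb := hb M N hN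
  let w : M → M → M → Option (Fin k ⊕ Fin 2) → M := fun b x y o =>
    o.elim b (Sum.elim (fun i => (p i : M)) ![x, y])
  have hw : ∀ (b : M) (x y : N), (fun o : Option (Fin k ⊕ Fin 2) => o.elim b fun i =>
      ((Sum.elim p ![x, y] i : N) : M)) = w b x y := by
    intro b x y
    ext o
    rcases o with _ | i | i
    · rfl
    · rfl
    · fin_cases i <;> rfl
  have key : ∀ (b : M) (x y : N), (b ∉ N → φ.Realize (Sum.elim p ![x, y]) →
      Formula.Realize ψ (w b x y)) ∧
      (b ∈ N → Formula.Realize ψ (w b x y) → φ.Realize (Sum.elim p ![x, y])) := by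
    intro b x y
    have := hb (Sum.elim p ![x, y]) default b
    rw [hw, show (fun i => ((default : Fin 0 → N) i : M)) = default from Subsingleton.elim _ _]
      at this
    exact this
  have hp : Mod.D0 fun b : M => ∀ x < (v : M), ∃ y < b, Formula.Realize ψ (w b x y) := by
    refine .ballLT (.cst (v : M)) (.bexLT (.var _) ?_)
    refine (Def.of_formula hψ (F := fun o => o.elim (fun _ u => u (some (some ())))
      (Sum.elim (fun i _ _ => (p i : M)) ![fun _ u => u (some none), fun _ u => u none])) ?_).of_iff
      fun i v => iff_of_eq (congrArg _ (funext fun o => ?_))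
    · rintro (_ | i | i)
      · exact .var _
      · exact .cst _
      · fin_cases i
        · exact .var _
        · exact .var _
    · rcases o with _ | i | i
      · rfl
      · rfl
      · fin_cases i <;> rfl
  have hlarge : ∀ b ∉ N, ∀ x < (v : M), ∃ y < b, Formula.Realize ψ (w b x y) := by
    intro b hbN x hx
    obtain ⟨y, hy⟩ := h ⟨x, hN _ v.2 x hx⟩ ((map_Lt N.subtype _ _).1 hx)
    exact ⟨y, not_le.1 fun hc => hbN (hN.mem_of_le y.2 hc), (key b _ y).1 hbN hy⟩
  obtain ⟨b, hb, hmin⟩ := hp.least (hlarge c hc)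
  have hbN : b ∈ N := by
    by_contra hbN
    have hb0 : b ≠ 0 := by
      rintro rfl
      have := (fzero N).2
      rw [show ((fzero N : N) : M) = 0 from map_fzero N.subtype] at this
      exact hbN this
    -- As `N` is closed under successor, the predecessor is outside `N` too and would be a smaller
    -- bound.
    obtain ⟨b, rfl⟩ := Mod.exists_eq_add_one hb0
    refine hmin b (Mod.lt_add_one.2 le_rfl) (hlarge b fun hbN' => hbN ?_)
    have := (fsucc (⟨b, hbN'⟩ : N)).2
    rwa [show ((fsucc (⟨b, hbN'⟩ : N) : N) : M) = b + 1 from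
      (map_fsucc N.subtype _).trans (M.fsucc_eq b)] at this
  refine ⟨⟨b, hbN⟩, fun x hx => ?_⟩
  obtain ⟨y, hy, hψy⟩ := hb x ((map_Lt N.subtype _ _).2 hx)
  exact ⟨⟨y, hN b hbN y hy⟩, (map_Lt N.subtype _ _).1 hy, (key b x ⟨y, hN b hbN y hy⟩).2 hbN hψy⟩

end InitialSegment

/-! ### Fixed points of a self-embedding and the proof of the theorem. -/

section SelfEmbedding

variable {M : Mod.{u}} (j : M ↪[LA] M)

lemma map_zero : j 0 = 0 := map_fzero j
lemma map_one : j 1 = 1 := (map_fsucc j _).trans (congrArg _ (map_fzero j))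
lemma map_add (a b : M) : j (a + b) = j a + j b := map_fadd j a b
lemma map_mul (a b : M) : j (a * b) = j a * j b := map_fmul j a b
lemma map_lt (a b : M) : j a < j b ↔ a < b := map_Lt j a b

lemma map_two_mul (a : M) : j (2 * a) = 2 * j a := by
  rw [two_mul, two_mul, map_add]

lemma mem_Ifix {m : M} : m ∈ Ifix j ↔ ∀ x ≤ m, j x = x := Iff.rfl

variable {j}

lemma Ifix_downward {a b : M} (ha : a ∈ Ifix j) (h : b ≤ a) : b ∈ Ifix j :=
  fun x hx => (mem_Ifix j).1 ha x (le_trans hx h)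

lemma Ifix_zero : (0 : M) ∈ Ifix j := by
  rw [mem_Ifix]
  intro x hx
  rw [nonpos_iff_eq_zero.1 hx, map_zero]

lemma Ifix_add {a b : M} (ha : a ∈ Ifix j) (hb : b ∈ Ifix j) : a + b ∈ Ifix j := by
  rw [mem_Ifix] at *
  intro x hx
  rcases le_total x a with h | h
  · exact ha x h
  · obtain ⟨y, rfl⟩ := exists_add_of_le h
    rw [map_add, ha a le_rfl, hb y (le_of_add_le_add_left hx)]

lemma Ifix_mul {a b : M} (ha : a ∈ Ifix j) (hb : b ∈ Ifix j) : a * b ∈ Ifix j := by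
  rcases (zero_le (a := a)).eq_or_lt with rfl | ha0
  · rw [zero_mul]; exact ha
  rw [mem_Ifix] at *
  intro x hx
  -- An element up to `a * b` is composed of `a`, a quotient at most `b` and a remainder below `a`,
  -- all fixed.
  obtain ⟨q, -, r, hr, rfl⟩ := Mod.exists_div ha0 x
  have hq : q ≤ b := le_of_mul_le_mul_left (le_self_add.trans hx) ha0
  rw [map_add, map_mul, ha a le_rfl, hb q hq, ha r hr.le]

lemma Ifix_succ {a : M} (ha : a ∈ Ifix j) : a + 1 ∈ Ifix j := by
  rw [mem_Ifix] at *
  intro x hx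
  rcases hx.lt_or_eq with h | rfl
  · exact ha x (Mod.lt_add_one.1 h)
  · rw [map_add, map_one, ha a le_rfl]

variable (j) in
/-- The substructure with universe `Ifix j`. -/
def ifixSubstructure : LA.Substructure M where
  carrier := Ifix j
  fun_mem {n} f x hx := by
    cases f with
    | zero =>
      convert Ifix_zero (j := j)
      exact congrArg _ (Subsingleton.elim _ _)
    | succ =>
      convert Ifix_succ (hx 0) using 1
      rw [← M.fsucc_eq]
      exact congrArg _ (funext fun i => by fin_cases i; rfl)
    | add =>
      convert Ifix_add (hx 0) (hx 1) using 1
      exact congrArg _ (funext fun i => by fin_cases i <;> rfl)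
    | mul =>
      convert Ifix_mul (hx 0) (hx 1) using 1
      exact congrArg _ (funext fun i => by fin_cases i <;> rfl)

lemma isInitial_ifixSubstructure : IsInitial (ifixSubstructure j) :=
  fun _ ha _ hb => Ifix_downward ha (.inl hb)

/-- `j` is an isomorphism onto its range, and `Δ₀`-formulae are absolute between the range and `M`.
-/
lemma IsDelta0Elementary.realize (hj : IsDelta0Elementary j.toHom.range) {k : ℕ}
    {φ : LA.Formula (Fin k)} (hφ : IsDelta0 φ) (v : Fin k → M) :
    φ.Realize (fun i => j (v i)) ↔ φ.Realize v := by
  rw [← StrongHomClass.realize_formula j.equivRange φ (v := v)]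
  exact (hj k φ hφ fun i => j.equivRange (v i)).symm

variable {E : LA.Formula (Fin 2)}

lemma Def.realize_pair {I Γ α : Type*} {𝓜 : I → Mod.{u}} {ρ : ∀ i, Γ → 𝓜 i}
    {f g : ∀ i, (α → 𝓜 i) → 𝓜 i} (hE : IsDelta0 E) (hf : Tm ρ f) (hg : Tm ρ g) :
    Def ρ fun i v => E.Realize ![f i v, g i v] :=
  (Def.of_formula hE (F := ![f, g]) (by simp [Fin.forall_fin_two, hf, hg])).of_iff fun i v =>
    iff_of_eq (congrArg _ (funext fun b => by fin_cases b <;> rfl))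

/-- If all `i ≤ a` are fixed by `j`, then so are all elements below `2 ^ a`, or all elements
whatsoever if `2 ^ a` does not exist. -/
theorem map_eq_of_lt_exp (hE : IsDelta0 E) (h0 : E.Realize ![(0 : M), 1])
    (hu : ∀ x y z : M, E.Realize ![x, y] → E.Realize ![x, z] → y = z)
    (hs : ∀ x y : M, E.Realize ![x, y] → E.Realize ![x + 1, 2 * y])
    (hjE : ∀ x y : M, E.Realize ![x, y] → E.Realize ![j x, j y])
    {a x : M} (ha : a ∈ Ifix j) (hx : ∀ p, E.Realize ![a, p] → x < p) : j x = x := by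
  rw [mem_Ifix] at ha
  by_contra hne
  -- Here `p = 2 ^ i`, and `q`, `q'` are the quotients of `x` and `j x` by it. The element `j x`
  -- enters as a parameter, so `j` is absent from the formula.
  have hp : Mod.D0 fun i : M => i ≤ a → ∃ p ≤ x + j x, E.Realize ![i, p] ∧
      ∃ q ≤ x, ∃ s < p, ∃ q' ≤ j x, ∃ s' < p,
        x = p * q + s ∧ j x = p * q' + s' ∧ q ≠ q' := by
    refine .imp (.le (.var _) (.cst a)) (.bexLE (.cst (x + j x)) (.and
      (.realize_pair hE (.var _) (.var _)) (.bexLE (.cst x) (.bexLT (.var _) (.bexLE (.cst (j x))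
      (.bexLT (.var _) (.and (.eq (.cst x) (.add (.mul (.var _) (.var _)) (.var _)))
      (.and (.eq (.cst (j x)) (.add (.mul (.var _) (.var _)) (.var _)))
      (.ne (.var _) (.var _))))))))))
  -- Distinct quotients are not both `0`, so `p` is at most `x` or at most `j x`.
  have hle : ∀ {p q q' s s' : M}, 0 < p → x = p * q + s → j x = p * q' + s' → q ≠ q' →
      p ≤ x + j x := by
    intro p q q' s s' _ e e' hq
    rcases eq_or_ne q 0 with rfl | hq0
    · have : 1 ≤ q' := Mod.one_le_iff.2 (pos_iff_ne_zero.2 hq.symm)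
      rw [e']
      exact ((le_mul_of_one_le_right zero_le this).trans le_self_add).trans le_add_self
    · have : 1 ≤ q := Mod.one_le_iff.2 (pos_iff_ne_zero.2 hq0)
      rw [e]
      exact ((le_mul_of_one_le_right zero_le this).trans le_self_add).trans le_self_add
  obtain ⟨p, -, hpE, q, -, s, hs, q', -, s', hs', e, e', hq⟩ := hp.induction (by
    intro _
    have e : x = 1 * x + 0 := by simp
    have e' : j x = 1 * j x + 0 := by simp
    exact ⟨1, hle one_pos e e' (Ne.symm hne), h0, x, le_rfl, 0, one_pos, j x, le_rfl, 0, one_pos,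
      e, e', Ne.symm hne⟩) (by
    intro i ih hia
    have hi : i ≤ a := (Mod.add_one_le.1 hia).le
    obtain ⟨p, -, hpE, q, -, s, hsp, q', -, s', hs', e, e', hq⟩ := ih hi
    have hjp : j p = p := hu i _ _ (by simpa [ha i hi] using hjE i p hpE) hpE
    have hp0 : 0 < p := pos_of_gt hsp
    have hjs : j s < p := by rw [← hjp]; exact (map_lt j s p).2 hsp
    -- Applying `j` to the division of `x` by the fixed `p` gives a division of `j x`, so `q' = j q`
    -- and `s' = j s`.
    obtain ⟨rfl, rfl⟩ := Mod.div_unique (q := j q) (q' := q') hjs hs'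
      (by rw [← e', ← hjp, ← map_mul, ← map_add, ← e])
    have next : ∀ Q t, t < 2 * p → x = 2 * p * Q + t → j Q ≠ Q → ∃ p ≤ x + j x,
        E.Realize ![i + 1, p] ∧ ∃ q ≤ x, ∃ s < p, ∃ q' ≤ j x, ∃ s' < p,
          x = p * q + s ∧ j x = p * q' + s' ∧ q ≠ q' := by
      intro Q t ht e hQ
      have h2p : 0 < 2 * p := mul_pos two_pos hp0
      have e' : j x = 2 * p * j Q + j t := by
        conv_lhs => rw [e]
        rw [map_add, map_mul, map_two_mul, hjp]
      have ht' : j t < 2 * p := by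
        rw [← hjp, ← map_two_mul]; exact (map_lt j _ _).2 ht
      have h1 : 1 ≤ 2 * p := Mod.one_le_iff.2 h2p
      refine ⟨2 * p, hle h2p e e' hQ.symm, hs i p hpE, Q, ?_, t, ht, j Q, ?_, j t, ht', e, e',
        hQ.symm⟩
      · exact (le_mul_of_one_le_left zero_le h1).trans (le_self_add.trans_eq e.symm)
      · exact (le_mul_of_one_le_left zero_le h1).trans (le_self_add.trans_eq e'.symm)
    -- The last binary digit of `q` moves into the remainder. It is fixed by `j`, so if `Q` were
    -- fixed, `q` would be.
    obtain ⟨Q, rfl | rfl⟩ := Mod.even_or_odd q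
    · refine next Q s (hsp.trans_le (le_mul_of_one_le_left zero_le one_le_two))
        (e.trans (by ring)) fun h => hq ?_
      rw [map_two_mul, h]
    · refine next Q (p + s) ?_ (e.trans (by ring)) fun h => hq ?_
      · rw [two_mul]; gcongr
      · rw [map_add, map_two_mul, h, map_one]) a le_rfl
  have hxp := hx p hpE
  have hjp : j p = p := hu a _ _ (by simpa [ha a le_rfl] using hjE a p hpE) hpE
  have hjxp : j x < p := by rw [← hjp]; exact (map_lt j x p).2 hxp
  -- At `i = a` both `x` and `j x` are below `p`, so both quotients are `0`.
  have h1 := (Mod.div_unique (b := p) (q := 0) (q' := q) hxp hs (by rw [← e]; simp)).1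
  have h2 := (Mod.div_unique (b := p) (q := 0) (q' := q') hjxp hs' (by rw [← e']; simp)).1
  exact hq (h1.symm.trans h2)

/-- The longest initial segment of fixed points of a nontrivial `Δ₀`-elementary self-embedding is a
model of `IΔ₀ + BΣ₁ + Exp`. -/
theorem ifixSubstructure_models (hj : j ≠ Language.Embedding.refl LA M)
    (hjM : IsDelta0Elementary j.toHom.range) (hE : IsExpGraph E) :
    (ifixSubstructure j ⊨ IDelta0 ∪ BSigma1 ∪ {totality E}) ∧
      ∀ a ∈ ifixSubstructure j, ∃ b ∈ ifixSubstructure j, E.Realize ![a, b] := by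
  have hne : Nonempty M := ⟨0⟩
  have hM := M.models
  have hz : E.Realize ![(0 : M), 1] :=
    realize_exp_zero.1 (hE.zero.realize_sentence M)
  have hu := realize_exp_unique.1 (hE.unique.realize_sentence M)
  have hs : ∀ x y : M, E.Realize ![x, y] → E.Realize ![x + 1, 2 * y] := by
    intro x y h
    rw [show 2 * y = (1 + 1) * y by rw [one_add_one_eq_two] ]
    exact realize_exp_succ.1 (hE.succ.realize_sentence M) x y h
  have hjE : ∀ x y : M, E.Realize ![x, y] → E.Realize ![j x, j y] := by
    intro x y h
    have := (hjM.realize hE.delta0 ![x, y]).2 h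
    convert this using 1
    ext i
    fin_cases i <;> rfl
  obtain ⟨c, hc⟩ : ∃ c, j c ≠ c := by
    by_contra! h
    exact hj (Language.Embedding.ext h)
  have hlt : ∀ {a x : M}, a ∈ Ifix j → (∀ p, E.Realize ![a, p] → x < p) → j x = x :=
    fun ha hx => map_eq_of_lt_exp hE.delta0 hz hu hs hjE ha hx
  have hI : IsInitial (ifixSubstructure j) := isInitial_ifixSubstructure
  have hexp : ∀ a : M, a ∈ Ifix j → ∃ b ∈ Ifix j, E.Realize ![a, b] := by
    intro a ha
    by_cases hp : ∃ p, E.Realize ![a, p]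
    · obtain ⟨p, hp⟩ := hp
      refine ⟨p, ?_, hp⟩
      rintro x (hx | rfl)
      · exact hlt ha fun p' hp' => hu a p p' hp hp' ▸ hx
      -- The power itself is fixed because its image is also the power of the fixed exponent `a`.
      · refine hu a _ _ ?_ hp
        have := hjE a x hp
        rwa [show j a = a from ha a (.inr rfl)] at this
    -- Without a power for `a`, the condition `x < 2 ^ a` is vacuous and even the moved element `c`
    -- would be fixed.
    · exact (hc (hlt ha fun p h => (hp ⟨p, h⟩).elim)).elim
  have hcI : c ∉ ifixSubstructure j := fun h => hc (h c (.inr rfl))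
  refine ⟨?_, hexp⟩
  rw [Language.Theory.model_union_iff, Language.Theory.model_union_iff,
    Language.Theory.model_singleton_iff]
  refine ⟨⟨hI.models_IDelta0, hI.models_BSigma1 hcI⟩, realize_totality.2 fun a => ?_⟩
  obtain ⟨b, hb, h⟩ := hexp a a.2
  refine ⟨⟨b, hb⟩, (hE.delta0.realize_initial hI _ _).2 ?_⟩
  convert h using 1
  refine iff_of_eq (congrArg₂ _ (funext fun i => ?_) (Subsingleton.elim _ _))
  fin_cases i <;> rfl

end SelfEmbedding

end Arith

theorem theorem3p2 {M : Type u} [LA.Structure M] (hM : M ⊨ Arith.IDelta0)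
    (j : M ↪[LA] M) (hj : j ≠ Language.Embedding.refl LA M)
    (hjM : Arith.IsDelta0Elementary j.toHom.range) :
    (∃ E : LA.Formula (Fin 2), Arith.IsExpGraph E) ∧
      ∀ E : LA.Formula (Fin 2), Arith.IsExpGraph E →
        ∃ I : LA.Substructure M, (I : Set M) = Arith.Ifix j ∧
          (I ⊨ Arith.IDelta0 ∪ Arith.BSigma1 ∪ {Arith.totality E}) ∧
          ∀ a ∈ I, ∃ b ∈ I, E.Realize ![a, b] := by
  exact ⟨Arith.exists_isExpGraph, fun E hE => ⟨Arith.ifixSubstructure (M := ⟨M, hM⟩) j, rfl,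
    Arith.ifixSubstructure_models (M := ⟨M, hM⟩) hj hjM hE⟩⟩
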